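/- Let $N\ge 1$ and $k\ge 3$ be integers, $\mu_N=e^{2\pi i/N}$, $v\in(\mathbb Z/N)^2$. For pairs $u=(m,n)$, $v=(c,d)$ (integral or modulo $N$) put $(u|v)=md-nc$, and let $SL_2(\mathbb Z)$ act on row vectors from the right. For $\tau\in\mathbb H$ define $$G_k^v(\tau)=\sum_{\substack{(m,n)\in\mathbb Z^2\setminus\{(0,0)\}\\ (m,n)\equiv v \bmod N}}\frac1{(m\tau+n)^k},\qquad H_k^v(\tau)=\sum_{u=(m,n)\in\mathbb Z^2\setminus\{(0,0)\}}\frac{\mu_N^{(v|u)}}{(m\tau+n)^k},\qquad \xi_k^v=\frac{(k-1)!}{(2\pi i)^k}H_k^v .$$ For $\gamma=\begin{pmatrix}a&b\\c&d\end{pmatrix}\in SL_2(\mathbb Z)$ and a polynomial $P(X,Y)$ let $P|_\gamma=P(aX+bY,cX+dY)$; write $(\delta P)(\gamma)=P|_\gamma-P$, and let $\mathrm{Re}\,P$ denote the polynomial whose coefficients are the real parts of those of $P$. For $f$ with constant term $a_0$ at $i\infty$ put $$I_f(\tau)=2\pi i\sum_{p=0}^{k-2}\binom{k-2}{p}(-1)^pX^{k-2-p}Y^p\left(-\frac{a_0\tau^{p+1}}{p+1}+\int_\tau^{i\infty}(f(z)-a_0)z^p\,dz\right),$$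 the regularised integral of $2\pi i f(z)(X-zY)^{k-2}dz$ from $\tau$ to the unit tangent vector at $i\infty$. Put $$C_f(\gamma)=I_f(\gamma\tau)|_\gamma-I_f(\tau),\qquad C_k^v(\gamma)=I_{\xi_k^{v\gamma^{-1}}}(\gamma\tau)\big|_\gamma-I_{\xi_k^v}(\tau),\qquad \widetilde C_{G_k^v}(\gamma)=I_{G_k^{v\gamma^{-1}}}(\gamma\tau)\big|_\gamma-I_{G_k^v}(\tau).$$ With $\mathrm{Li}_m(z)=\sum_{n\ge1}z^n/n^m$, let $\mathrm{Cl}_m(x)$ be the real part of $\mathrm{Li}_m(e^{ix})$ if $m$ is odd and its imaginary part if $m$ is even. For $v=(a,b)$ let $$A_{\xi_k^v}=(-1)^{k-1+\lceil k/2\rceil}\,\delta_{a,0}\,\frac{(k-2)!}{(2\pi)^{k-2}}\,\mathrm{Cl}_{k-1}\!\left(\tfrac{2\pi b}{N}\right),\qquad P_{\xi_k^v}=A_{\xi_k^v}Y^{k-2},$$ $$A_{G_k^v}=\frac{(-1)^{\lfloor k/2\rfloor}(2\pi)^k}{N^2(k-1)!}\sum_{u\in(\mathbb Z/N)^2}A_{\xi_k^u}\cdot\begin{cases}\cos\frac{2\pi(u|v)}N,&k\text{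 even},\\ \sin\frac{2\pi(u|v)}N,&k\text{ odd},\end{cases}\qquad P_{G_k^v}=A_{G_k^v}Y^{k-2}$$ (here $\delta_{a,0}=1$ if $a\equiv0\bmod N$ and $0$ otherwise). **Theorem.** For every choice of the base point $\tau\in\mathbb H$ the following hold. 1. For all $\gamma\in SL_2(\mathbb Z)$, $\ \mathrm{Re}\,C_k^v(\gamma)=P_{\xi_k^{v\gamma^{-1}}}\big|_\gamma-P_{\xi_k^v}$. 2. If $\gamma\in\Gamma(N)$, then $v\gamma=v$ in $(\mathbb Z/N)^2$, and on $\Gamma(N)$ the real part of the cocycle of $\xi_k^v$ is a coboundary: $\mathrm{Re}\,C_{\xi_k^v}=\delta(P_{\xi_k^v})=A_{\xi_k^v}\,\delta(Y^{k-2})$. 3. The same holds for $G_k^v$: for all $\gamma\in SL_2(\mathbb Z)$, $\ \mathrm{Re}\,\widetilde C_{G_k^v}(\gamma)=P_{G_k^{v\gamma^{-1}}}\big|_\gamma-P_{G_k^v}$, and on $\Gamma(N)$, $\ \mathrm{Re}\,C_{G_k^v}=\delta(P_{G_k^v})=A_{G_k^v}\,\delta(Y^{k-2})$. -/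

import Mathlib

open scoped Real MatrixGroups

namespace EisensteinCocycle

noncomputable section

/-! ### Row vectors modulo `N` and the symplectic pairing -/

/-- The right action `v γ` of `SL₂(ℤ)` on row vectors `v ∈ (ℤ/N)²`. -/
def rowAct {N : ℕ} (v : Fin 2 → ZMod N) (γ : SL(2, ℤ)) : Fin 2 → ZMod N :=
  Matrix.vecMul v (γ.1.map (Int.cast : ℤ → ZMod N))

/-- The pairing `(u|v) = m d - n c` of `u = (m, n)` and `v = (c, d)`. -/
def symp {N : ℕ} (u v : Fin 2 → ZMod N) : ZMod N := u 0 * v 1 - u 1 * v 0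

/-- Reduction modulo `N` of an integral row vector. -/
def redMod (N : ℕ) (u : Fin 2 → ℤ) : Fin 2 → ZMod N := fun i => (u i : ZMod N)

/-! ### Eisenstein series -/

/-- `G_k^v(τ)`: the sum of `(m τ + n)^(-k)` over all nonzero `(m, n) ∈ ℤ²` congruent to `v`. -/
def eisG {N : ℕ} (k : ℕ) (v : Fin 2 → ZMod N) (τ : UpperHalfPlane) : ℂ :=
  ∑' u : {u : Fin 2 → ℤ // u ≠ 0 ∧ redMod N u = v},
    1 / ((u.1 0 : ℂ) * (τ : ℂ) + (u.1 1 : ℂ)) ^ k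

/-- `H_k^v(τ)`: the sum of `μ_N^(v|u) (m τ + n)^(-k)` over all nonzero `u = (m, n) ∈ ℤ²`,
with `μ_N = exp (2 π i / N)` (`ZMod.stdAddChar j = μ_N ^ j`). -/
def eisH {N : ℕ} [NeZero N] (k : ℕ) (v : Fin 2 → ZMod N) (τ : UpperHalfPlane) : ℂ :=
  ∑' u : {u : Fin 2 → ℤ // u ≠ 0},
    ZMod.stdAddChar (symp v (redMod N u.1)) / ((u.1 0 : ℂ) * (τ : ℂ) + (u.1 1 : ℂ)) ^ k

/-- The normalised series `ξ_k^v = (k-1)! / (2 π i)^k · H_k^v`. -/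
def eisXi {N : ℕ} [NeZero N] (k : ℕ) (v : Fin 2 → ZMod N) (τ : UpperHalfPlane) : ℂ :=
  ((k - 1).factorial : ℂ) / (2 * (π : ℂ) * Complex.I) ^ k * eisH k v τ

/-! ### Polynomials in `X = X 0`, `Y = X 1` -/

/-- The right action `P|_γ (X, Y) = P (a X + b Y, c X + d Y)`. -/
def polyAct {R : Type*} [CommRing R] (P : MvPolynomial (Fin 2) R) (γ : SL(2, ℤ)) :
    MvPolynomial (Fin 2) R :=
  MvPolynomial.aeval
    (fun i : Fin 2 => ((γ.1 i 0 : ℤ) : MvPolynomial (Fin 2) R) * MvPolynomial.X 0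
      + ((γ.1 i 1 : ℤ) : MvPolynomial (Fin 2) R) * MvPolynomial.X 1) P

/-- The real part of a polynomial, taken coefficient by coefficient. -/
def polyRe (P : MvPolynomial (Fin 2) ℂ) : MvPolynomial (Fin 2) ℝ :=
  ∑ m ∈ P.support, MvPolynomial.monomial m (MvPolynomial.coeff m P).re

theorem coeff_polyRe (P : MvPolynomial (Fin 2) ℂ) (m : Fin 2 →₀ ℕ) :
    MvPolynomial.coeff m (polyRe P) = (MvPolynomial.coeff m P).re := by
  classical
  unfold polyRe
  rw [MvPolynomial.coeff_sum]
  simp only [MvPolynomial.coeff_monomial]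
  rw [Finset.sum_ite_eq']
  split_ifs with h
  · rfl
  · rw [MvPolynomial.notMem_support_iff.mp h, Complex.zero_re]

/-- The coboundary `δ P : Γ → V`, `γ ↦ P|_γ - P`, of a `0`-cochain `P` of a subgroup `Γ`. -/
def coboundary {R : Type*} [CommRing R] (Γ : Subgroup SL(2, ℤ)) (P : MvPolynomial (Fin 2) R) :
    Γ → MvPolynomial (Fin 2) R :=
  fun γ => polyAct P (γ : SL(2, ℤ)) - P

/-! ### Regularised Eichler integrals and cocycles -/

/-- The regularised integral from `τ` to the unit tangent vector at the cusp `i∞` of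
`f(z) z^p dz`, that is `-a₀ τ^(p+1) / (p+1) + ∫_τ^{i∞} (f(z) - a₀) z^p dz`, where `a₀` is the
constant term of `f` at `i∞` and the integral runs along the vertical ray `z = τ + i t`. -/
def regIntegral (f : UpperHalfPlane → ℂ) (p : ℕ) (τ : UpperHalfPlane) : ℂ :=
  -(UpperHalfPlane.valueAtInfty f * (τ : ℂ) ^ (p + 1) / ((p : ℂ) + 1))
    + ∫ t in Set.Ioi (0 : ℝ),
        (f (UpperHalfPlane.ofComplex ((τ : ℂ) + (t : ℂ) * Complex.I))
            - UpperHalfPlane.valueAtInfty f)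
          * ((τ : ℂ) + (t : ℂ) * Complex.I) ^ p * Complex.I

/-- `I_f(τ)`: the regularised integral from `τ` to the unit tangent vector at `i∞` of
`2 π i f(z) (X - z Y)^(k-2) dz`, expanded in powers of `z`. -/
def eichlerIntegral (k : ℕ) (f : UpperHalfPlane → ℂ) (τ : UpperHalfPlane) :
    MvPolynomial (Fin 2) ℂ :=
  ∑ p ∈ Finset.range (k - 1),
    MvPolynomial.C (2 * (π : ℂ) * Complex.I * ((k - 2).choose p : ℂ) * (-1) ^ p
        * regIntegral f p τ)
      * MvPolynomial.X 0 ^ (k - 2 - p) * MvPolynomial.X 1 ^ p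

/-- `C_f(γ) = I_f(γ τ)|_γ - I_f(τ)`, computed from the base point `τ`. -/
def cocycle (k : ℕ) (f : UpperHalfPlane → ℂ) (τ : UpperHalfPlane) (γ : SL(2, ℤ)) :
    MvPolynomial (Fin 2) ℂ :=
  polyAct (eichlerIntegral k f (γ • τ)) γ - eichlerIntegral k f τ

/-- The extended cochain `γ ↦ I_{F^{vγ⁻¹}}(γ τ)|_γ - I_{F^v}(τ)` on `SL₂(ℤ)` attached to a family
`F^v` indexed by `v ∈ (ℤ/N)²`, computed from the base point `τ`. -/
def extCocycle {N : ℕ} (k : ℕ) (F : (Fin 2 → ZMod N) → UpperHalfPlane → ℂ)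
    (v : Fin 2 → ZMod N) (τ : UpperHalfPlane) (γ : SL(2, ℤ)) : MvPolynomial (Fin 2) ℂ :=
  polyAct (eichlerIntegral k (F (rowAct v γ⁻¹)) (γ • τ)) γ - eichlerIntegral k (F v) τ

/-! ### Clausen values -/

/-- The polylogarithm series `Li_m(z) = ∑_{n ≥ 1} z^n / n^m`. -/
def polylog (m : ℕ) (z : ℂ) : ℂ := ∑' n : ℕ, z ^ (n + 1) / ((n : ℂ) + 1) ^ m

/-- Clausen's function: the real part (`m` odd) or imaginary part (`m` even) of
`Li_m(exp (i x))`. -/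
def clausen (m : ℕ) (x : ℝ) : ℝ :=
  if Odd m then (polylog m (Complex.exp ((x : ℂ) * Complex.I))).re
  else (polylog m (Complex.exp ((x : ℂ) * Complex.I))).im

/-- The constant `A_{ξ_k^v}` for `v = (a, b)`; the exponent `(k + 1) / 2` is `⌈k/2⌉`. -/
def aXi {N : ℕ} (k : ℕ) (v : Fin 2 → ZMod N) : ℝ :=
  if v 0 = 0 then
    (-1) ^ (k - 1 + (k + 1) / 2) * (((k - 2).factorial : ℝ) / (2 * π) ^ (k - 2))
      * clausen (k - 1) (2 * π * ((v 1).val : ℝ) / (N : ℝ))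
  else 0

/-- The constant `A_{G_k^v}`; the exponent `k / 2` is `⌊k/2⌋`. -/
def aG {N : ℕ} [NeZero N] (k : ℕ) (v : Fin 2 → ZMod N) : ℝ :=
  (-1) ^ (k / 2) * (2 * π) ^ k / ((N : ℝ) ^ 2 * ((k - 1).factorial : ℝ))
    * ∑ u : Fin 2 → ZMod N, aXi k u *
        (if Even k then Real.cos (2 * π * ((symp u v).val : ℝ) / (N : ℝ))
         else Real.sin (2 * π * ((symp u v).val : ℝ) / (N : ℝ)))

/-- `A · Y^(k-2)`; `P_{ξ_k^v}` and `P_{G_k^v}` are the cases `A = A_{ξ_k^v}`, `A = A_{G_k^v}`. -/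
def pPoly (k : ℕ) (A : ℝ) : MvPolynomial (Fin 2) ℝ :=
  MvPolynomial.C A * MvPolynomial.X 1 ^ (k - 2)

end

end EisensteinCocycle

open EisensteinCocycle

/-! Put w = k - 2 and fix real X, Y. On vertical lines the real part of 2πi ξ(z) (X - zY)^w dz has
an explicit primitive: a constant times a real analytic Eisenstein series K, whose summands are
y/|q|² times a geometric sum in A/q and its conjugate, with q = mz + n and A = X - zY (`eisKernel`,
`kernelSeries`). The derivative of a summand in y is (w + 1) Re(A^w / q^(w+2))
(`hasDerivAt_eisKernel`). The symmetry u ↦ -u of the coefficients and the parity of the factor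
(2πi)^(1-k) then assemble these real parts into the real part of the integrand. The summand is
unchanged when γ acts simultaneously on (X, Y), on z and on u (`eisKernel_smul`). Hence K is
equivariant and contributes nothing to the cocycle. Only the boundary term at i∞ survives in Re I =
A_ξ Y^w - (equivariant term), and the real part of the cocycle is its coboundary
(`re_sum_regIntegral`, `polyRe_extCocycle_of_equivariant`). The boundary term is found row by row in
m. The row m = 0 is exactly what the regularisation at the tangent vector removes
(`eisKernel_zero_one`). For m ≠ 0 the sum over n is a Riemann sum of mesh 1/y; as y → ∞ it tends to
the mean over n of the character times an elementary integral, π (-Y)^w / (|m| m^w)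
(`tendsto_kernelSeries_sub`, `integral_scaledKernel`). The mean vanishes unless the first coordinate
of v is 0, and the remaining sum over m is a real or imaginary part of Li_(k-1), which is the
Clausen value (`re_kernelLimit_sympChar`). For G, Fourier inversion on (ℤ/N)² combined with u ↦ -u
gives a linear combination of the ξ^u with real coefficients depending only on (u|v), so the formula
for the real part carries over (`eisG_eq_sum_eisXi`). -/

open Filter Topology MeasureTheory

/-! ### Riemann sums over shifted lattices -/

/-- The step function `t ↦ h (⌊t / h - θ⌋ + θ)` with values in the shifted lattice `h (ℤ + θ)`. -/
noncomputable def latticeStep (h θ t : ℝ) : ℝ := h * (⌊t / h - θ⌋ + θ)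

namespace latticeStep

theorem abs_sub_le {h : ℝ} (hh : 0 < h) (θ t : ℝ) : |latticeStep h θ t - t| ≤ h := by
  have h1 := Int.floor_le (t / h - θ)
  have h2 := (Int.lt_floor_add_one (t / h - θ)).le
  have ht : t = h * (t / h) := by field_simp
  unfold latticeStep
  rw [abs_le]
  constructor
  · have := mul_le_mul_of_nonneg_left h2 hh.le
    nlinarith
  · have := mul_le_mul_of_nonneg_left h1 hh.le
    nlinarith

theorem measurable (h θ : ℝ) : Measurable (latticeStep h θ) := by
  unfold latticeStep
  have : Measurable fun t : ℝ => ((⌊t / h - θ⌋ : ℤ) : ℝ) :=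
    measurable_from_top.comp (Int.measurable_floor.comp (by fun_prop))
  fun_prop

/-- After t = h(x + θ) the integrand is constant on each [n, n + 1), so the lattice sum equals the
integral of a step function exactly. Limits as h → 0 thus become dominated convergence for
integrals. -/
theorem hasSum {h : ℝ} (hh : 0 < h) (θ : ℝ) {g : ℝ → ℂ}
    (hg : Integrable fun t => g (latticeStep h θ t)) :
    HasSum (fun n : ℤ => (h : ℂ) * g (h * (n + θ))) (∫ t, g (latticeStep h θ t)) := by
  set F : ℝ → ℂ := fun x => (h : ℂ) * g (h * (⌊x⌋ + θ)) with hF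
  have key : ∀ x : ℝ, latticeStep h θ (h * (x + θ)) = h * (⌊x⌋ + θ) := by
    intro x
    have : h * (x + θ) / h - θ = x := by field_simp; ring
    rw [latticeStep, this]
  have hint : Integrable F := by
    have h1 := (hg.comp_mul_left' hh.ne').comp_add_right θ
    simp only [key] at h1
    exact h1.const_mul _
  have hval : ∫ x, F x = ∫ t, g (latticeStep h θ t) := by
    have h1 : ∫ x : ℝ, g (latticeStep h θ (h * (x + θ))) = ∫ x : ℝ, g (latticeStep h θ (h * x)) :=
      integral_add_right_eq_self (fun x => g (latticeStep h θ (h * x))) θ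
    have h2 := Measure.integral_comp_mul_left (fun t => g (latticeStep h θ t)) h
    simp only [key] at h1
    rw [hF, integral_const_mul, h1, h2, abs_of_pos (inv_pos.mpr hh), Complex.real_smul]
    push_cast
    rw [← mul_assoc, mul_inv_cancel₀ (by exact_mod_cast hh.ne'), one_mul]
  have := hint.hasSum_intervalIntegral_comp_add_int
  rw [hval] at this
  have hfun : (fun n : ℤ => (h : ℂ) * g (h * (n + θ))) =
      fun n : ℤ => ∫ x in (0:ℝ)..1, F (x + n) := by
    funext n
    symm
    have : ∫ x in (0:ℝ)..1, F (x + n) = ∫ x in (0:ℝ)..1, (h : ℂ) * g (h * (n + θ)) := by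
      apply intervalIntegral.integral_congr_ae
      -- The floor jumps at the right endpoint, which is a null set.
      have : ∀ᵐ x : ℝ, x ≠ 1 := by
        simp [ae_iff]
      filter_upwards [this] with x hx hx'
      rw [Set.uIoc_of_le zero_le_one] at hx'
      have : ⌊x⌋ = 0 := Int.floor_eq_zero_iff.mpr ⟨hx'.1.le, lt_of_le_of_ne hx'.2 hx⟩
      simp [hF, this]
    rw [this]
    simp
  rw [hfun]
  exact this

/-- With |s - t| ≤ 1 one has t² ≤ 2s² + 2, hence 1 + t² ≤ 3(1 + s²). This gives a dominating
function independent of h and θ. -/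
theorem inv_one_add_sq_le {h : ℝ} (hh : 0 < h) (h1 : h ≤ 1) (θ t : ℝ) :
    (1 + latticeStep h θ t ^ 2)⁻¹ ≤ 3 * (1 + t ^ 2)⁻¹ := by
  have h2 := (abs_sub_le hh θ t).trans h1
  set s := latticeStep h θ t
  rw [← div_eq_mul_inv, inv_eq_one_div, div_le_div_iff₀ (by positivity) (by positivity)]
  rw [abs_le] at h2
  nlinarith [sq_nonneg (s + (s - t)), sq_nonneg (2 * s - t), sq_nonneg (s - t)]

theorem norm_le {h : ℝ} (hh : 0 < h) (h1 : h ≤ 1) (θ t : ℝ) {g : ℝ → ℂ} {C : ℝ}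
    (hC : ∀ t, ‖g t‖ ≤ C * (1 + t ^ 2)⁻¹) :
    ‖g (latticeStep h θ t)‖ ≤ 3 * C * (1 + t ^ 2)⁻¹ := by
  have hC0 : 0 ≤ C := by simpa using (norm_nonneg _).trans (hC 0)
  calc _ ≤ C * (1 + latticeStep h θ t ^ 2)⁻¹ := hC _
    _ ≤ C * (3 * (1 + t ^ 2)⁻¹) := by gcongr; exact inv_one_add_sq_le hh h1 θ t
    _ = _ := by ring

theorem integrable {h : ℝ} (hh : 0 < h) (h1 : h ≤ 1) (θ : ℝ) {g : ℝ → ℂ} (hg : Measurable g)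
    {C : ℝ} (hC : ∀ t, ‖g t‖ ≤ C * (1 + t ^ 2)⁻¹) :
    Integrable fun t => g (latticeStep h θ t) :=
  (integrable_inv_one_add_sq.const_mul (3 * C)).mono'
    (hg.comp (measurable h θ)).aestronglyMeasurable
    (Eventually.of_forall fun t => norm_le hh h1 θ t hC)

end latticeStep

/-- The bound 3π is uniform in h and θ, as needed to dominate all rows m ≠ 0 simultaneously. -/
theorem hasSum_lattice_inv_one_add_sq {h : ℝ} (hh : 0 < h) (h1 : h ≤ 1) (θ : ℝ) :
    ∃ S ≤ 3 * π, HasSum (fun n : ℤ => h * (1 + (h * (n + θ)) ^ 2)⁻¹) S := by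
  set g : ℝ → ℂ := fun t => (((1 + t ^ 2)⁻¹ : ℝ) : ℂ) with hg
  have hgm : Measurable g := by fun_prop
  have hC : ∀ t, ‖g t‖ ≤ 1 * (1 + t ^ 2)⁻¹ := fun t => by
    rw [hg, Complex.norm_real, one_mul, Real.norm_of_nonneg (by positivity)]
  have hs := latticeStep.hasSum hh θ (latticeStep.integrable hh h1 θ hgm hC)
  refine ⟨∫ t, (1 + latticeStep h θ t ^ 2)⁻¹, ?_, ?_⟩
  · rw [← integral_univ_inv_one_add_sq, ← integral_const_mul]
    apply integral_mono_of_nonneg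
    · exact Eventually.of_forall fun t => by positivity
    · exact integrable_inv_one_add_sq.const_mul 3
    · exact Eventually.of_forall fun t => latticeStep.inv_one_add_sq_le hh h1 θ t
  · have h2 : ∫ t, g (latticeStep h θ t) = ((∫ t, (1 + latticeStep h θ t ^ 2)⁻¹ : ℝ) : ℂ) :=
      integral_ofReal
    rw [h2] at hs
    rw [← Complex.hasSum_ofReal]
    simpa [hg] using hs

/-- Riemann sums over shifted lattices `h (ℤ + θ)` converge to the integral as `h → 0`. -/
theorem tendsto_lattice_sum {G : ℝ → ℝ → ℂ} (hG : Continuous (Function.uncurry G)) {C : ℝ}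
    (hC : ∀ ε t, |ε| ≤ 1 → ‖G ε t‖ ≤ C * (1 + t ^ 2)⁻¹) (a θ : ℝ) :
    Tendsto (fun h : ℝ => ∑' n : ℤ, (h : ℂ) * G (h * a) (h * (n + θ))) (𝓝[>] 0)
      (𝓝 (∫ t, G 0 t)) := by
  have e1 : ∀ᶠ h : ℝ in 𝓝[>] 0, 0 < h ∧ h ≤ 1 ∧ |h * a| ≤ 1 := by
    have : Tendsto (fun h : ℝ => |h * a|) (𝓝 0) (𝓝 0) := by
      have : Continuous fun h : ℝ => |h * a| := by fun_prop
      simpa using this.tendsto 0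
    have h2 := (this.eventually (ge_mem_nhds (zero_lt_one))).filter_mono
      (nhdsWithin_le_nhds (s := Set.Ioi 0))
    filter_upwards [self_mem_nhdsWithin, h2, Ioo_mem_nhdsGT (zero_lt_one (α := ℝ))] with h h1 h2 h3
    exact ⟨h1, h3.2.le, h2⟩
  have hm : ∀ ε, Measurable (G ε) := fun ε =>
    (hG.comp (Continuous.prodMk_right ε)).measurable
  have e2 : (fun h : ℝ => ∑' n : ℤ, (h : ℂ) * G (h * a) (h * (n + θ))) =ᶠ[𝓝[>] 0]
      fun h => ∫ t, G (h * a) (latticeStep h θ t) := by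
    filter_upwards [e1] with h hh
    exact (latticeStep.hasSum hh.1 θ (latticeStep.integrable hh.1 hh.2.1 θ (hm _)
      (fun t => hC _ t hh.2.2))).tsum_eq
  refine Tendsto.congr' e2.symm ?_
  refine tendsto_integral_filter_of_dominated_convergence (fun t => 3 * C * (1 + t ^ 2)⁻¹) ?_ ?_
    (integrable_inv_one_add_sq.const_mul _) ?_
  · exact Eventually.of_forall fun h =>
      ((hm _).comp (latticeStep.measurable h θ)).aestronglyMeasurable
  · filter_upwards [e1] with h hh
    exact Eventually.of_forall fun t =>
      latticeStep.norm_le hh.1 hh.2.1 θ t (fun t => hC _ t hh.2.2)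
  · refine Eventually.of_forall fun t => ?_
    have l1 : Tendsto (fun h : ℝ => h * a) (𝓝[>] 0) (𝓝 0) := by
      have : Continuous fun h : ℝ => h * a := by fun_prop
      simpa using (this.tendsto 0).mono_left nhdsWithin_le_nhds
    have l2 : Tendsto (fun h : ℝ => latticeStep h θ t) (𝓝[>] 0) (𝓝 t) := by
      rw [tendsto_iff_norm_sub_tendsto_zero]
      refine squeeze_zero' (Eventually.of_forall fun _ => norm_nonneg _) ?_
        (tendsto_nhdsWithin_of_tendsto_nhds tendsto_id)
      filter_upwards [self_mem_nhdsWithin] with h hh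
      exact latticeStep.abs_sub_le hh θ t
    exact (hG.tendsto (0, t)).comp (l1.prodMk_nhds l2)

/-- Riemann sums twisted by an `N`-periodic function pick up its mean value. -/
theorem tendsto_lattice_sum_periodic {N : ℕ} [NeZero N] (ψ : ZMod N → ℂ) {G : ℝ → ℝ → ℂ}
    (hG : Continuous (Function.uncurry G)) {C : ℝ}
    (hC : ∀ ε t, |ε| ≤ 1 → ‖G ε t‖ ≤ C * (1 + t ^ 2)⁻¹) (a θ : ℝ) :
    Tendsto (fun h : ℝ => ∑' n : ℤ, ψ n * ((h : ℂ) * G (h * a) (h * (n + θ)))) (𝓝[>] 0)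
      (𝓝 ((∑ j, ψ j) / N * ∫ t, G 0 t)) := by
  have hN : (0 : ℝ) < N := Nat.cast_pos.mpr (NeZero.pos N)
  have hNc : (N : ℂ) ≠ 0 := Nat.cast_ne_zero.mpr (NeZero.ne N)
  have hm : ∀ ε, Measurable (G ε) := fun ε =>
    (hG.comp (Continuous.prodMk_right ε)).measurable
  have hscale : Tendsto (fun h : ℝ => N * h) (𝓝[>] 0) (𝓝[>] 0) := by
    refine tendsto_nhdsWithin_iff.mpr ⟨?_, ?_⟩
    · have : Continuous fun h : ℝ => N * h := by fun_prop
      simpa using (this.tendsto 0).mono_left nhdsWithin_le_nhds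
    · filter_upwards [self_mem_nhdsWithin] with h hh
      exact mul_pos hN hh
  -- Splitting n into residue classes j mod N leaves, in each class, the lattice of mesh Nh shifted
  -- by (j + θ)/N. The larger mesh accounts for the weight ψ(j)/N.
  have lim : Tendsto (fun h : ℝ => ∑ j : Fin N, ψ (j.1 : ZMod N) / N *
      ∑' n : ℤ, ((N * h : ℝ) : ℂ) * G ((N * h) * (a / N)) ((N * h) * (n + (j.1 + θ) / N)))
      (𝓝[>] 0) (𝓝 (∑ j : Fin N, ψ (j.1 : ZMod N) / N * ∫ t, G 0 t)) :=
    tendsto_finsetSum _ fun j _ =>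
      ((tendsto_lattice_sum hG hC (a / N) ((j.1 + θ) / N)).comp hscale).const_mul _
  have hsum : ∑ j : Fin N, ψ (j.1 : ZMod N) / N * ∫ t, G 0 t = (∑ j, ψ j) / N * ∫ t, G 0 t := by
    rw [← Finset.sum_mul, ← Finset.sum_div]
    congr 2
    refine Fintype.sum_bijective (fun j : Fin N => (j.1 : ZMod N)) ?_ _ _ (fun _ => rfl)
    constructor
    · intro i j hij
      have := congrArg ZMod.val hij
      rw [ZMod.val_natCast_of_lt i.2, ZMod.val_natCast_of_lt j.2] at this
      exact Fin.ext this
    · intro x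
      exact ⟨⟨x.val, ZMod.val_lt x⟩, by simp⟩
  rw [hsum] at lim
  refine lim.congr' ?_
  have e1 : ∀ᶠ h : ℝ in 𝓝[>] 0, 0 < h ∧ N * h ≤ 1 ∧ |h * a| ≤ 1 := by
    have : Tendsto (fun h : ℝ => |h * a|) (𝓝 0) (𝓝 0) := by
      have : Continuous fun h : ℝ => |h * a| := by fun_prop
      simpa using this.tendsto 0
    have h2 := (this.eventually (ge_mem_nhds (zero_lt_one))).filter_mono
      (nhdsWithin_le_nhds (s := Set.Ioi 0))
    filter_upwards [self_mem_nhdsWithin, h2,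
      hscale.eventually (Ioo_mem_nhdsGT (zero_lt_one (α := ℝ)))] with h h1 h2 h3
    exact ⟨h1, h3.2.le, h2⟩
  filter_upwards [e1] with h hh
  symm
  have term : ∀ (n : ℤ) (j : Fin N), ψ (((j.1 : ℤ) + n * N : ℤ) : ZMod N) *
      ((h : ℂ) * G (h * a) (h * (((j.1 : ℤ) + n * N : ℤ) + θ))) = ψ (j.1 : ZMod N) / N *
      (((N * h : ℝ) : ℂ) * G ((N * h) * (a / N)) ((N * h) * (n + (j.1 + θ) / N))) := by
    intro n j
    have a1 : N * h * (a / N) = h * a := by field_simp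
    have a2 : (N * h) * (n + (j.1 + θ) / N) = h * (((j.1 : ℤ) + n * N : ℤ) + θ) := by
      push_cast; field_simp; ring
    rw [a1, a2]
    push_cast
    simp only [CharP.cast_eq_zero, mul_zero, add_zero]
    field_simp
  have hS : ∀ j : Fin N, HasSum (fun n : ℤ => ψ (j.1 : ZMod N) / N *
      (((N * h : ℝ) : ℂ) * G ((N * h) * (a / N)) ((N * h) * (n + (j.1 + θ) / N))))
      (ψ (j.1 : ZMod N) / N * ∑' n : ℤ,
        ((N * h : ℝ) : ℂ) * G ((N * h) * (a / N)) ((N * h) * (n + (j.1 + θ) / N))) := by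
    intro j
    have hb : |N * h * (a / N)| ≤ 1 := by
      have a1 : N * h * (a / N) = h * a := by field_simp
      rw [a1]; exact hh.2.2
    have := latticeStep.hasSum (mul_pos hN hh.1) ((j.1 + θ) / N)
      (latticeStep.integrable (mul_pos hN hh.1) hh.2.1 _ (hm _) (fun t => hC _ t hb))
    exact this.summable.hasSum.mul_left _
  have hsummable : Summable fun n : ℤ => ψ n * ((h : ℂ) * G (h * a) (h * (n + θ))) := by
    have h1 : h ≤ 1 := by
      have : (1 : ℝ) ≤ N := by exact_mod_cast NeZero.one_le
      nlinarith [hh.1, hh.2.1]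
    have h2 := (latticeStep.hasSum hh.1 θ (latticeStep.integrable hh.1 h1 θ (hm _)
      (fun t => hC _ t hh.2.2))).summable.norm
    refine Summable.of_norm_bounded (h2.mul_left (∑ j, ‖ψ j‖)) fun n => ?_
    rw [norm_mul]
    gcongr
    exact Finset.single_le_sum (f := fun j => ‖ψ j‖) (fun _ _ => norm_nonneg _)
      (Finset.mem_univ (n : ZMod N))
  rw [← (Int.divModEquiv N).symm.tsum_eq, ← (Equiv.prodComm (Fin N) ℤ).tsum_eq]
  have hs2 := ((Equiv.prodComm (Fin N) ℤ).summable_iff).mpr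
    ((Int.divModEquiv N).symm.summable_iff.mpr hsummable)
  have hs3 := hs2.tsum_prod
  simp only [Function.comp_def] at hs3
  rw [hs3, tsum_fintype]
  refine Finset.sum_congr rfl fun j _ => ?_
  rw [← (hS j).tsum_eq]
  refine tsum_congr fun n => ?_
  rw [← term]
  simp [Int.divModEquiv, add_comm]

/-! ### The kernel: derivative in y and invariance -/

/-- The linear form `m z + n` attached to `u = (m, n)`. -/
noncomputable def linForm (u : Fin 2 → ℤ) (z : ℂ) : ℂ := u 0 * z + u 1

/-- The summand `y / |q|² · ∑_{r + s = w} (A / q)^r (conj (A / q))^s`, with `q = m z + n` and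
`A = X - z Y`, of the real analytic Eisenstein series. -/
noncomputable def eisKernel (w : ℕ) (X Y : ℝ) (u : Fin 2 → ℤ) (z : ℂ) : ℂ :=
  ((z.im / Complex.normSq (linForm u z) : ℝ) : ℂ) * ∑ i ∈ Finset.range (w + 1),
    ((X - z * Y) / linForm u z) ^ i
      * (starRingEnd ℂ ((X - z * Y) / linForm u z)) ^ (w - i)

theorem geom_sum₂_mul_sub {R : Type*} [CommRing R] (a b : R) (w : ℕ) :
    (∑ i ∈ Finset.range (w + 1), a ^ i * b ^ (w - i)) * (a - b) = a ^ (w + 1) - b ^ (w + 1) :=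
  (Commute.all a b).geom_sum₂_mul (w + 1)

theorem conj_linForm (u : Fin 2 → ℤ) (z : ℂ) :
    starRingEnd ℂ (linForm u z) = linForm u (starRingEnd ℂ z) := by
  simp [linForm]

/-- The factor 2yℓ/|q|², with ℓ = mX + nY, is i times the difference of A/q and its conjugate, so
the geometric sum telescopes. The sum form of the kernel is kept because it stays meaningful when ℓ
= 0. -/
theorem eisKernel_mul (w : ℕ) (X Y : ℝ) (u : Fin 2 → ℤ) (z : ℂ) :
    eisKernel w X Y u z * (u 0 * X + u 1 * Y) * 2 = Complex.I *
      (((X - z * Y) / linForm u z) ^ (w + 1)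
        - (starRingEnd ℂ ((X - z * Y) / linForm u z)) ^ (w + 1)) := by
  by_cases hq : linForm u z = 0
  · simp [eisKernel, hq]
  rw [eisKernel, ← geom_sum₂_mul_sub]
  set S := ∑ i ∈ Finset.range (w + 1),
    ((X - z * Y) / linForm u z) ^ i
      * (starRingEnd ℂ ((X - z * Y) / linForm u z)) ^ (w - i)
  have hq' : starRingEnd ℂ (linForm u z) ≠ 0 := by simpa using hq
  have key : ((z.im / Complex.normSq (linForm u z) : ℝ) : ℂ) * (u 0 * X + u 1 * Y) * 2 =
      Complex.I * ((X - z * Y) / linForm u z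
        - starRingEnd ℂ ((X - z * Y) / linForm u z)) := by
    rw [map_div₀, Complex.ofReal_div, Complex.normSq_eq_conj_mul_self]
    have hz : (z.im : ℂ) = -Complex.I * (z - starRingEnd ℂ z) / 2 := by
      rw [Complex.sub_conj]
      push_cast
      linear_combination (z.im : ℂ) * Complex.I_mul_I
    field_simp
    rw [hz, conj_linForm]
    simp only [linForm, map_sub, map_mul, Complex.conj_ofReal]
    ring
  linear_combination S * key

/-- The mechanism is d/dy (A/q) = -iℓ/q² with ℓ = mX + nY: the numerator no longer depends on z. -/
theorem hasDerivAt_eisKernel (w : ℕ) (X Y : ℝ) (u : Fin 2 → ℤ) (x y : ℝ)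
    (hq : linForm u (x + y * Complex.I) ≠ 0) :
    HasDerivAt (fun y : ℝ => eisKernel w X Y u (x + y * Complex.I))
      ((((w + 1) * ((X - (x + y * Complex.I) * Y) ^ w
        / linForm u (x + y * Complex.I) ^ (w + 2)).re : ℝ)) : ℂ) y := by
  set z : ℝ → ℂ := fun y => x + y * Complex.I with hz
  have hz' : HasDerivAt z Complex.I y := by
    exact (((Complex.ofRealCLM.hasDerivAt (x := y)).mul_const Complex.I).const_add
      (x : ℂ)).congr_deriv (by simp)
  have hq1 : HasDerivAt (fun y => linForm u (z y)) (u 0 * Complex.I) y :=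
    (hz'.const_mul (u 0 : ℂ)).add_const _
  set ℓ : ℂ := u 0 * X + u 1 * Y with hℓ
  change linForm u (z y) ≠ 0 at hq
  have hA : HasDerivAt (fun y => (X - z y * Y) / linForm u (z y))
      (-Complex.I * ℓ / linForm u (z y) ^ 2) y := by
    have := ((hz'.mul_const (Y : ℂ)).const_sub (X : ℂ)).div hq1 hq
    refine this.congr_deriv ?_
    congr 1
    rw [linForm]
    ring
  have hAc : HasDerivAt (fun y => starRingEnd ℂ ((X - z y * Y) / linForm u (z y)))
      (starRingEnd ℂ (-Complex.I * ℓ / linForm u (z y) ^ 2)) y :=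
    hA.star
  have hℓc : starRingEnd ℂ ℓ = ℓ := by simp [hℓ]
  have hq' : starRingEnd ℂ (linForm u (z y)) ≠ 0 := by simpa using hq
  have hre : ∀ a : ℂ, (a.re : ℂ) = (a + starRingEnd ℂ a) / 2 := by
    intro a
    rw [Complex.add_conj]
    push_cast
    ring
  have hre' : (((X - z y * Y) ^ w / linForm u (z y) ^ (w + 2)).re : ℂ) =
      ((X - z y * Y) ^ w / linForm u (z y) ^ (w + 2)
      + starRingEnd ℂ (X - z y * Y) ^ w / starRingEnd ℂ (linForm u (z y)) ^ (w + 2)) / 2 := by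
    rw [hre, map_div₀, map_pow, map_pow]
  -- If ℓ = 0, then A/q is real with zero derivative, and only the prefactor y/|q|² varies.
  -- Otherwise `eisKernel_mul` can be divided by ℓ and differentiated.
  by_cases h0 : ℓ = 0
  · have hzero : (X - z y * Y) / linForm u (z y)
        = starRingEnd ℂ ((X - z y * Y) / linForm u (z y)) := by
      have := eisKernel_mul 0 X Y u (z y)
      rw [← hℓ, h0] at this
      simp only [mul_zero, zero_mul, zero_add, pow_one] at this
      exact sub_eq_zero.mp ((mul_eq_zero.mp this.symm).resolve_left Complex.I_ne_zero)
    rw [h0] at hA hAc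
    simp only [mul_zero, zero_div, map_zero] at hA hAc
    have hS : HasDerivAt (fun y => ∑ i ∈ Finset.range (w + 1),
        ((X - z y * Y) / linForm u (z y)) ^ i
          * (starRingEnd ℂ ((X - z y * Y) / linForm u (z y))) ^ (w - i)) 0 y := by
      have := HasDerivAt.fun_sum (u := Finset.range (w + 1)) fun i _ =>
        (hA.pow i).mul (hAc.pow (w - i))
      simpa using this
    have hB : HasDerivAt (fun y : ℝ => (((z y).im / Complex.normSq (linForm u (z y)) : ℝ) : ℂ))
        ((linForm u (z y) ^ 2)⁻¹ / 2 + (starRingEnd ℂ (linForm u (z y)) ^ 2)⁻¹ / 2) y := by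
      have him : ∀ y, (z y).im = y := by simp [hz]
      have e : (fun y : ℝ => (((z y).im / Complex.normSq (linForm u (z y)) : ℝ) : ℂ)) =
          fun y : ℝ => (y : ℂ) / (starRingEnd ℂ (linForm u (z y)) * linForm u (z y)) := by
        funext y
        rw [him, Complex.ofReal_div, Complex.normSq_eq_conj_mul_self]
      rw [e]
      have hq1c : HasDerivAt (fun y => starRingEnd ℂ (linForm u (z y)))
        (starRingEnd ℂ (u 0 * Complex.I)) y := hq1.star
      have := (Complex.ofRealCLM.hasDerivAt (x := y)).div (hq1c.mul hq1) (mul_ne_zero hq' hq)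
      refine this.congr_deriv ?_
      simp only [Complex.ofRealCLM_apply, Complex.ofReal_one, map_mul, Complex.conj_I, map_intCast,
        Pi.mul_apply]
      field_simp
      rw [conj_linForm]
      simp only [linForm, hz, map_add, map_mul, Complex.conj_ofReal, Complex.conj_I]
      ring_nf
    have := hB.mul hS
    refine this.congr_deriv ?_
    rw [mul_zero, add_zero, Complex.ofReal_mul]
    change _ = _ * (((X - z y * Y) ^ w / linForm u (z y) ^ (w + 2)).re : ℂ)
    rw [hre']
    have hsum : ∑ i ∈ Finset.range (w + 1), ((X - z y * Y) / linForm u (z y)) ^ i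
          * (starRingEnd ℂ ((X - z y * Y) / linForm u (z y))) ^ (w - i)
          = (w + 1) * ((X - z y * Y) / linForm u (z y)) ^ w := by
      rw [← hzero]
      rw [Finset.sum_congr rfl (g := fun _ => ((X - z y * Y) / linForm u (z y)) ^ w)]
      · simp
      · intro i hi
        rw [← pow_add, Nat.add_sub_cancel' (Nat.lt_succ_iff.mp (Finset.mem_range.mp hi))]
    rw [hsum]
    have h2 : starRingEnd ℂ (X - z y * Y) ^ w = ((X - z y * Y) / linForm u (z y)) ^ w
        * starRingEnd ℂ (linForm u (z y)) ^ w := by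
      rw [hzero, map_div₀, ← mul_pow, div_mul_cancel₀ _ hq']
    have h3 : (X - z y * Y) ^ w = ((X - z y * Y) / linForm u (z y)) ^ w
        * linForm u (z y) ^ w := by
      rw [← mul_pow, div_mul_cancel₀ _ hq]
    rw [h2, h3]
    generalize ((X - z y * Y) / linForm u (z y)) ^ w = D
    push_cast
    field_simp
    ring
  · have e : (fun y : ℝ => eisKernel w X Y u (z y)) = fun y => (((X - z y * Y)
        / linForm u (z y)) ^ (w + 1) - (starRingEnd ℂ ((X - z y * Y) / linForm u (z y))) ^ (w + 1))
        * (Complex.I / (2 * ℓ)) := by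
      funext y
      have := eisKernel_mul w X Y u (z y)
      rw [← hℓ] at this
      field_simp
      linear_combination this
    rw [e]
    have := ((hA.pow (w + 1)).sub (hAc.pow (w + 1))).mul_const (Complex.I / (2 * ℓ))
    refine this.congr_deriv ?_
    rw [Complex.ofReal_mul]
    change _ = _ * (((X - z y * Y) ^ w / linForm u (z y) ^ (w + 2)).re : ℂ)
    rw [hre']
    simp only [map_div₀, map_pow, map_mul, map_neg, Complex.conj_I, hℓc, Nat.add_sub_cancel,
      div_pow]
    push_cast
    field_simp
    ring_nf
    simp only [Complex.I_sq]
    ring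

theorem norm_geom_sum₂_conj_le (a : ℂ) (w : ℕ) :
    ‖∑ i ∈ Finset.range (w + 1), a ^ i * (starRingEnd ℂ a) ^ (w - i)‖ ≤ (w + 1) * ‖a‖ ^ w := by
  refine (norm_sum_le _ _).trans ?_
  rw [Finset.sum_congr rfl (g := fun _ => ‖a‖ ^ w)]
  · simp
  · intro i hi
    rw [norm_mul, norm_pow, norm_pow, RCLike.norm_conj, ← pow_add,
      Nat.add_sub_cancel' (Nat.lt_succ_iff.mp (Finset.mem_range.mp hi))]

theorem norm_eisKernel_le (w : ℕ) (X Y : ℝ) (u : Fin 2 → ℤ) (z : ℂ) :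
    ‖eisKernel w X Y u z‖ ≤ |z.im| * ((w + 1) * ‖(X - z * Y : ℂ)‖ ^ w)
      * (‖linForm u z‖ ^ (w + 2))⁻¹ := by
  rw [eisKernel, norm_mul, Complex.norm_real, Complex.normSq_eq_norm_sq, norm_div,
    Real.norm_eq_abs, Real.norm_eq_abs, abs_of_nonneg (sq_nonneg ‖linForm u z‖)]
  refine (mul_le_mul_of_nonneg_left (norm_geom_sum₂_conj_le _ w) (by positivity)).trans (le_of_eq ?_)
  rw [norm_div, div_pow, pow_add]
  field_simp

theorem linForm_ne_zero {u : Fin 2 → ℤ} (hu : u ≠ 0) {z : ℂ} (hz : 0 < z.im) :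
    linForm u z ≠ 0 := by
  intro h
  have h1 := congrArg Complex.im h
  simp only [linForm, Complex.add_im, Complex.mul_im, Complex.intCast_re, Complex.intCast_im,
    zero_mul, add_zero, Complex.zero_im] at h1
  have h0 : u 0 = 0 := by
    rcases mul_eq_zero.mp h1 with h | h
    · exact_mod_cast h
    · exact absurd h hz.ne'
  have h2 : u 1 = 0 := by
    rw [linForm, h0] at h
    simpa using h
  exact hu (by ext i; fin_cases i <;> simp [h0, h2])

/-- Invariance of the kernel under `SL₂(ℤ)`. -/
theorem eisKernel_smul (w : ℕ) (X Y : ℝ) (u : Fin 2 → ℤ) (γ : SL(2, ℤ)) (τ : UpperHalfPlane) :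
    eisKernel w (γ.1 0 0 * X + γ.1 0 1 * Y) (γ.1 1 0 * X + γ.1 1 1 * Y) u
        ((γ • τ : UpperHalfPlane) : ℂ)
      = eisKernel w X Y (Matrix.vecMul u γ.1) τ := by
  by_cases hu : u = 0
  · simp [hu, eisKernel, linForm]
  have hden : ((γ.1 1 0 : ℂ) * τ + γ.1 1 1) ≠ 0 := by
    have := UpperHalfPlane.denom_ne_zero (γ : GL (Fin 2) ℝ) τ
    simpa [UpperHalfPlane.denom] using this
  have hdet : (γ.1 0 0 : ℂ) * γ.1 1 1 - γ.1 0 1 * γ.1 1 0 = 1 := by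
    have := γ.2
    rw [Matrix.det_fin_two] at this
    exact_mod_cast this
  have hcoe : ((γ • τ : UpperHalfPlane) : ℂ)
      = ((γ.1 0 0 : ℂ) * τ + γ.1 0 1) / ((γ.1 1 0 : ℂ) * τ + γ.1 1 1) := by
    rw [UpperHalfPlane.specialLinearGroup_apply]
    simp
  set d : ℂ := (γ.1 1 0 : ℂ) * τ + γ.1 1 1 with hd
  -- Both q and A acquire the factor 1/(cz + d), and Im z the factor 1/|cz + d|². Hence A/q and
  -- y/|q|² are preserved once u is replaced by uγ.
  have hlin : linForm u ((γ • τ : UpperHalfPlane) : ℂ)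
      = linForm (Matrix.vecMul u γ.1) τ / d := by
    rw [hcoe]
    simp only [linForm, Matrix.vecMul, dotProduct, Fin.sum_univ_two]
    push_cast
    field_simp
    rw [hd]
    ring
  have hX : (((γ.1 0 0 * X + γ.1 0 1 * Y : ℝ) : ℂ)
      - ((γ • τ : UpperHalfPlane) : ℂ) * ((γ.1 1 0 * X + γ.1 1 1 * Y : ℝ) : ℂ))
      = (X - τ * Y) / d := by
    rw [hcoe]
    push_cast
    field_simp
    rw [hd]
    linear_combination (X - τ * Y : ℂ) * hdet
  have him : ((γ • τ : UpperHalfPlane) : ℂ).im = (τ : ℂ).im / Complex.normSq d := by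
    have := ModularGroup.im_smul_eq_div_normSq γ τ
    rw [UpperHalfPlane.coe_im, UpperHalfPlane.coe_im, this]
    simp [UpperHalfPlane.denom, hd]
  have hnd : Complex.normSq d ≠ 0 := by simpa using hden
  rw [eisKernel, eisKernel, hX, hlin, him, Complex.normSq_div, div_div_div_cancel_right₀ hnd,
    div_div_div_cancel_right₀ hden]

/-! ### The rescaled kernel: bounds and integral -/

/-- The kernel for `m ≠ 0` in the rescaled variables `ε = (X - x Y) / y` and `t = (n + m x) / y`. -/
noncomputable def scaledKernel (w : ℕ) (Y : ℝ) (m : ℤ) (ε t : ℝ) : ℂ :=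
  (((m : ℝ) ^ 2 + t ^ 2)⁻¹ : ℝ) * ∑ i ∈ Finset.range (w + 1),
    ((ε - Complex.I * Y) / (Complex.I * m + t)) ^ i
      * (starRingEnd ℂ ((ε - Complex.I * Y) / (Complex.I * m + t))) ^ (w - i)

/-- With h = 1/y, the factor h in front turns the sum over n into a Riemann sum of mesh h and shift
mx. -/
theorem eisKernel_eq_scaledKernel (w : ℕ) (X Y : ℝ) (u : Fin 2 → ℤ) (x : ℝ) {h : ℝ} (hh : 0 < h) :
    eisKernel w X Y u (x + (h⁻¹ : ℝ) * Complex.I)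
      = h * scaledKernel w Y (u 0) (h * (X - x * Y)) (h * (u 1 + u 0 * x)) := by
  have hc : (h : ℂ) ≠ 0 := by exact_mod_cast hh.ne'
  have hlin : linForm u (x + (h⁻¹ : ℝ) * Complex.I)
      = (Complex.I * u 0 + ((h * (u 1 + u 0 * x) : ℝ) : ℂ)) / h := by
    rw [linForm]; push_cast; field_simp; ring
  have hA : (X - (x + (h⁻¹ : ℝ) * Complex.I) * Y : ℂ)
      = (((h * (X - x * Y) : ℝ) : ℂ) - Complex.I * Y) / h := by
    push_cast; field_simp; ring
  have hn : Complex.normSq (Complex.I * u 0 + ((h * (u 1 + u 0 * x) : ℝ) : ℂ))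
      = (u 0 : ℝ) ^ 2 + (h * (u 1 + u 0 * x)) ^ 2 := by
    rw [Complex.normSq_apply]
    simp
    ring
  rw [eisKernel, scaledKernel, hA, hlin, Complex.normSq_div, hn, div_div_div_cancel_right₀ hc,
    ← mul_assoc]
  congr 1
  rw [← Complex.ofReal_mul]
  congr 1
  simp
  field_simp

theorem I_mul_add_ne_zero {m : ℤ} (hm : m ≠ 0) (t : ℝ) : (Complex.I * m + t : ℂ) ≠ 0 := by
  intro h
  have := congrArg Complex.im h
  simp at this
  exact hm this

theorem abs_le_norm_I_mul_add (m : ℤ) (t : ℝ) : |(m : ℝ)| ≤ ‖(Complex.I * m + t : ℂ)‖ := by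
  have := Complex.abs_im_le_norm (Complex.I * m + t : ℂ)
  simpa using this

theorem continuous_scaledKernel (w : ℕ) (Y : ℝ) {m : ℤ} (hm : m ≠ 0) :
    Continuous (Function.uncurry (scaledKernel w Y m)) := by
  have h1 : ∀ p : ℝ × ℝ, (Complex.I * m + p.2 : ℂ) ≠ 0 := fun p => I_mul_add_ne_zero hm p.2
  have h2 : ∀ p : ℝ × ℝ, ((m : ℝ) ^ 2 + p.2 ^ 2) ≠ 0 := fun p => by
    have : (m : ℝ) ≠ 0 := by exact_mod_cast hm
    positivity
  have hB : Continuous fun p : ℝ × ℝ => ((p.1 - Complex.I * Y) / (Complex.I * m + p.2) : ℂ) :=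
    Continuous.div (by fun_prop) (by fun_prop) h1
  have hB' : Continuous fun p : ℝ × ℝ =>
      starRingEnd ℂ ((p.1 - Complex.I * Y) / (Complex.I * m + p.2) : ℂ) :=
    Complex.continuous_conj.comp hB
  have h3 : Continuous fun p : ℝ × ℝ => ((m : ℝ) ^ 2 + p.2 ^ 2)⁻¹ :=
    Continuous.inv₀ (by fun_prop) h2
  unfold Function.uncurry scaledKernel
  exact (Complex.continuous_ofReal.comp h3).mul
    (continuous_finsetSum _ fun i _ => (hB.pow i).mul (hB'.pow (w - i)))

/-- The factor (m² + t²)⁻¹ is reserved for the sum over n and |m|^(-w) for the sum over m. -/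
theorem norm_scaledKernel_le (w : ℕ) (Y : ℝ) {m : ℤ} (hm : m ≠ 0) {ε : ℝ} (hε : |ε| ≤ 1) (t : ℝ) :
    ‖scaledKernel w Y m ε t‖ ≤
      (w + 1) * (1 + |Y|) ^ w * (|(m : ℝ)| ^ w)⁻¹ * ((m : ℝ) ^ 2 + t ^ 2)⁻¹ := by
  have hm' : 0 < |(m : ℝ)| := by positivity
  rw [scaledKernel, norm_mul, Complex.norm_real, Real.norm_of_nonneg (by positivity)]
  have h1 : ‖((ε - Complex.I * Y) / (Complex.I * m + t) : ℂ)‖ ≤ (1 + |Y|) * |(m : ℝ)|⁻¹ := by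
    rw [norm_div, div_eq_mul_inv]
    gcongr
    · refine (norm_sub_le _ _).trans ?_
      simp only [Complex.norm_real, Real.norm_eq_abs, norm_mul, Complex.norm_I, one_mul]
      gcongr
    · exact abs_le_norm_I_mul_add m t
  calc _ ≤ ((m : ℝ) ^ 2 + t ^ 2)⁻¹ * ((w + 1) * ((1 + |Y|) * |(m : ℝ)|⁻¹) ^ w) := by
        gcongr
        exact (norm_geom_sum₂_conj_le _ w).trans (by gcongr)
    _ = _ := by rw [mul_pow, inv_pow]; ring

theorem one_le_sq_of_ne_zero {m : ℤ} (hm : m ≠ 0) : (1 : ℝ) ≤ (m : ℝ) ^ 2 := by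
  have : (1 : ℤ) ≤ m ^ 2 := by
    have := sq_pos_of_ne_zero hm
    lia
  exact_mod_cast this

theorem inv_sq_add_sq_eq {m : ℤ} (hm : m ≠ 0) (h s : ℝ) :
    h * ((m : ℝ) ^ 2 + (h * s) ^ 2)⁻¹
      = |(m : ℝ)|⁻¹ * (h / |(m : ℝ)| * (1 + (h / |(m : ℝ)| * s) ^ 2)⁻¹) := by
  have hm' : 0 < |(m : ℝ)| := by positivity
  have e : (m : ℝ) ^ 2 + (h * s) ^ 2 = |(m : ℝ)| ^ 2 * (1 + (h / |(m : ℝ)| * s) ^ 2) := by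
    rw [← sq_abs (m : ℝ)]
    field_simp
  rw [e, mul_inv]
  field_simp

/-- Dividing by |m| reduces to m = 1 with the finer mesh h/|m| ≤ 1, at the price of the factor
1/|m|. -/
theorem tsum_lattice_inv_sq_add_sq_le {m : ℤ} (hm : m ≠ 0) {h : ℝ} (hh : 0 < h) (h1 : h ≤ 1)
    (θ : ℝ) : Summable (fun n : ℤ => h * ((m : ℝ) ^ 2 + (h * (n + θ)) ^ 2)⁻¹) ∧
      ∑' n : ℤ, h * ((m : ℝ) ^ 2 + (h * (n + θ)) ^ 2)⁻¹ ≤ 3 * π * |(m : ℝ)|⁻¹ := by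
  have hm' : 0 < |(m : ℝ)| := by positivity
  have hm1 : 1 ≤ |(m : ℝ)| := by
    have := one_le_sq_of_ne_zero hm
    rwa [one_le_sq_iff_one_le_abs] at this
  simp only [inv_sq_add_sq_eq hm]
  obtain ⟨S, hS, hsum⟩ := hasSum_lattice_inv_one_add_sq (div_pos hh hm')
    (div_le_one_of_le₀ (h1.trans hm1) hm'.le) θ
  have := hsum.mul_left |(m : ℝ)|⁻¹
  refine ⟨this.summable, ?_⟩
  rw [this.tsum_eq, mul_comm]
  gcongr

theorem integrable_inv_sq_add_sq {m : ℤ} (hm : m ≠ 0) :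
    Integrable (fun t : ℝ => ((m : ℝ) ^ 2 + t ^ 2)⁻¹) := by
  have h1 := one_le_sq_of_ne_zero hm
  refine integrable_inv_one_add_sq.mono' (by fun_prop) (Eventually.of_forall fun t => ?_)
  rw [Real.norm_of_nonneg (by positivity)]
  gcongr

theorem integral_univ_inv_sq_add_sq {m : ℤ} (hm : m ≠ 0) :
    ∫ t : ℝ, ((m : ℝ) ^ 2 + t ^ 2)⁻¹ = π * |(m : ℝ)|⁻¹ := by
  have hm' : 0 < |(m : ℝ)| := by positivity
  have e : ∀ t : ℝ, ((m : ℝ) ^ 2 + t ^ 2)⁻¹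
      = (|(m : ℝ)| ^ 2)⁻¹ * (1 + (|(m : ℝ)|⁻¹ * t) ^ 2)⁻¹ := by
    intro t
    rw [← mul_inv]
    congr 1
    rw [← sq_abs (m : ℝ)]
    field_simp
  simp only [e]
  rw [integral_const_mul, Measure.integral_comp_mul_left (fun t => (1 + t ^ 2)⁻¹),
    integral_univ_inv_one_add_sq, inv_inv, abs_abs, smul_eq_mul]
  field_simp

theorem norm_inv_sub_I_mul (m : ℤ) (t : ℝ) :
    ‖((m - Complex.I * t)⁻¹ : ℂ)‖ ^ 2 = ((m : ℝ) ^ 2 + t ^ 2)⁻¹ := by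
  rw [norm_inv, inv_pow, ← Complex.normSq_eq_norm_sq, Complex.normSq_apply]
  simp
  ring

theorem norm_inv_sub_I_mul_le {m : ℤ} (hm : m ≠ 0) (t : ℝ) :
    ‖((m - Complex.I * t)⁻¹ : ℂ)‖ ≤ 1 := by
  have h1 := one_le_sq_of_ne_zero hm
  have h2 := norm_inv_sub_I_mul m t
  have h3 : ((m : ℝ) ^ 2 + t ^ 2)⁻¹ ≤ 1 := inv_le_one_of_one_le₀ (by nlinarith [sq_nonneg t])
  rw [← h2] at h3
  exact (sq_le_one_iff₀ (norm_nonneg _)).mp h3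

theorem sub_I_mul_ne_zero {m : ℤ} (hm : m ≠ 0) (t : ℝ) : (m - Complex.I * t : ℂ) ≠ 0 := by
  intro h
  have := congrArg Complex.re h
  simp at this
  exact hm this

theorem integrable_inv_sub_I_mul_pow {m : ℤ} (hm : m ≠ 0) (w : ℕ) :
    Integrable (fun t : ℝ => ((m - Complex.I * t)⁻¹ : ℂ) ^ (w + 2)) := by
  refine (integrable_inv_sq_add_sq hm).mono' ?_ (Eventually.of_forall fun t => ?_)
  · have : Continuous fun t : ℝ => ((m - Complex.I * t)⁻¹ : ℂ) :=
      Continuous.inv₀ (by fun_prop) (sub_I_mul_ne_zero hm)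
    exact (this.pow _).aestronglyMeasurable
  · rw [norm_pow, pow_add, norm_inv_sub_I_mul]
    exact mul_le_of_le_one_left (by positivity)
      (pow_le_one₀ (norm_nonneg _) (norm_inv_sub_I_mul_le hm t))

/-- The exponent is at least 2, so the integrand has a power primitive that vanishes at both ends.
-/
theorem integral_inv_sub_I_mul_pow {m : ℤ} (hm : m ≠ 0) (w : ℕ) :
    ∫ t : ℝ, ((m - Complex.I * t)⁻¹ : ℂ) ^ (w + 2) = 0 := by
  have hw : (w + 1 : ℂ) ≠ 0 := by exact_mod_cast Nat.succ_ne_zero w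
  have hd : ∀ t : ℝ, HasDerivAt
      (fun t : ℝ => ((m - Complex.I * t)⁻¹ : ℂ) ^ (w + 1) / (Complex.I * (w + 1)))
      (((m - Complex.I * t)⁻¹ : ℂ) ^ (w + 2)) t := by
    intro t
    have h0 : HasDerivAt (fun t : ℝ => (m - Complex.I * t : ℂ)) (-Complex.I) t :=
      (((Complex.ofRealCLM.hasDerivAt (x := t)).const_mul Complex.I).const_sub
        (m : ℂ)).congr_deriv (by simp)
    have h1 := ((h0.inv (sub_I_mul_ne_zero hm t)).pow (w + 1)).div_const (Complex.I * (w + 1))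
    refine h1.congr_deriv ?_
    have := sub_I_mul_ne_zero hm t
    have hI := Complex.I_ne_zero
    simp only [Pi.inv_apply, Nat.add_sub_cancel, neg_neg]
    simp only [inv_pow]
    push_cast
    field_simp
    ring
  have hlim : ∀ l : Filter ℝ, Tendsto (fun t : ℝ => t ^ 2) l atTop → Tendsto
      (fun t : ℝ => ((m - Complex.I * t)⁻¹ : ℂ) ^ (w + 1) / (Complex.I * (w + 1))) l (𝓝 0) := by
    intro l hl
    have h1 : Tendsto (fun t : ℝ => ((m : ℝ) ^ 2 + t ^ 2)⁻¹) l (𝓝 0) :=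
      (tendsto_atTop_add_const_left _ _ hl).inv_tendsto_atTop
    have h2 : Tendsto (fun t : ℝ => ((m - Complex.I * t)⁻¹ : ℂ)) l (𝓝 0) := by
      rw [tendsto_zero_iff_norm_tendsto_zero]
      have h3 := h1.sqrt
      simp only [← norm_inv_sub_I_mul, Real.sqrt_sq (norm_nonneg _), Real.sqrt_zero] at h3
      exact h3
    have := (h2.pow (w + 1)).div_const (Complex.I * (w + 1))
    simpa using this
  have := integral_of_hasDerivAt_of_tendsto hd (integrable_inv_sub_I_mul_pow hm w)
    (hlim atBot (by simpa [Function.comp_def] using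
      (tendsto_pow_atTop (α := ℝ) two_ne_zero).comp tendsto_abs_atBot_atTop))
    (hlim atTop (tendsto_pow_atTop two_ne_zero))
  simpa using this

/-- For p = 1/(m - it) and q = 1/(m + it) the hypothesis says 1/p + 1/q = 2m. Peeling off either end
of the longer geometric sum and adding the results leaves pure powers, whose integrals vanish;
raising w by one therefore divides the integral by m. -/
theorem geom_sum₂_recursion {p q : ℂ} {m : ℂ} (hpq : p + q = 2 * m * (p * q)) (w : ℕ) :
    2 * m * (p * q * ∑ i ∈ Finset.range (w + 2), p ^ i * q ^ (w + 1 - i))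
      = p ^ (w + 2) + q ^ (w + 2)
        + 2 * (p * q * ∑ i ∈ Finset.range (w + 1), p ^ i * q ^ (w - i)) := by
  have h1 : ∑ i ∈ Finset.range (w + 2), p ^ i * q ^ (w + 1 - i)
      = p ^ (w + 1) + q * ∑ i ∈ Finset.range (w + 1), p ^ i * q ^ (w - i) := by
    rw [Finset.sum_range_succ, Nat.sub_self, pow_zero, mul_one, add_comm, Finset.mul_sum]
    congr 1
    refine Finset.sum_congr rfl fun i hi => ?_
    rw [Nat.sub_add_comm (Nat.lt_succ_iff.mp (Finset.mem_range.mp hi))]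
    ring
  have h2 : ∑ i ∈ Finset.range (w + 2), p ^ i * q ^ (w + 1 - i)
      = q ^ (w + 1) + p * ∑ i ∈ Finset.range (w + 1), p ^ i * q ^ (w - i) := by
    rw [Finset.sum_range_succ', Finset.mul_sum, add_comm]
    congr 1
    · simp
    · refine Finset.sum_congr rfl fun i hi => ?_
      rw [Nat.add_sub_add_right]
      ring
  generalize (∑ i ∈ Finset.range (w + 1), p ^ i * q ^ (w - i)) = S at *
  generalize (∑ i ∈ Finset.range (w + 2), p ^ i * q ^ (w + 1 - i)) = T at *
  linear_combination -T * hpq + p * h1 + q * h2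

theorem integral_geom_sum₂ {m : ℤ} (hm : m ≠ 0) (w : ℕ) :
    Integrable (fun t : ℝ => (((m : ℝ) ^ 2 + t ^ 2)⁻¹ : ℝ) * ∑ i ∈ Finset.range (w + 1),
      ((m - Complex.I * t)⁻¹ : ℂ) ^ i * (starRingEnd ℂ (m - Complex.I * t)⁻¹) ^ (w - i)) ∧
    ∫ t : ℝ, (((m : ℝ) ^ 2 + t ^ 2)⁻¹ : ℝ) * ∑ i ∈ Finset.range (w + 1),
      ((m - Complex.I * t)⁻¹ : ℂ) ^ i * (starRingEnd ℂ (m - Complex.I * t)⁻¹) ^ (w - i)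
      = π * ((|(m : ℝ)|⁻¹ : ℝ) : ℂ) / m ^ w := by
  have hmc : (m : ℂ) ≠ 0 := by exact_mod_cast hm
  induction w with
  | zero =>
    simp only [zero_add, Finset.range_one, Finset.sum_singleton, pow_zero, mul_one, Nat.sub_self,
      div_one]
    refine ⟨(integrable_inv_sq_add_sq hm).ofReal, ?_⟩
    rw [integral_complex_ofReal, integral_univ_inv_sq_add_sq hm]
    push_cast
    ring
  | succ w ih =>
    have e : ∀ t : ℝ, ((((m : ℝ) ^ 2 + t ^ 2)⁻¹ : ℝ) * ∑ i ∈ Finset.range (w + 1 + 1),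
      ((m - Complex.I * t)⁻¹ : ℂ) ^ i * (starRingEnd ℂ (m - Complex.I * t)⁻¹) ^ (w + 1 - i))
      = (((m - Complex.I * t)⁻¹ : ℂ) ^ (w + 2) + starRingEnd ℂ (((m - Complex.I * t)⁻¹ : ℂ) ^ (w + 2)))
          / (2 * m)
        + ((((m : ℝ) ^ 2 + t ^ 2)⁻¹ : ℝ) * ∑ i ∈ Finset.range (w + 1),
      ((m - Complex.I * t)⁻¹ : ℂ) ^ i * (starRingEnd ℂ (m - Complex.I * t)⁻¹) ^ (w - i)) / m := by
      intro t
      have hn0 := sub_I_mul_ne_zero hm t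
      have hn1 : (m + Complex.I * t : ℂ) ≠ 0 := by
        simpa [sub_eq_add_neg] using sub_I_mul_ne_zero hm (-t)
      have hq : starRingEnd ℂ ((m - Complex.I * t)⁻¹ : ℂ) = (m + Complex.I * t)⁻¹ := by
        simp
      have hpq : (((m : ℝ) ^ 2 + t ^ 2)⁻¹ : ℝ)
          = ((m - Complex.I * t)⁻¹ * (m + Complex.I * t)⁻¹ : ℂ) := by
        rw [← mul_inv]
        push_cast
        congr 1
        linear_combination (t : ℂ) ^ 2 * Complex.I_sq
      have hpq2 : ((m - Complex.I * t)⁻¹ + (m + Complex.I * t)⁻¹ : ℂ)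
          = 2 * m * ((m - Complex.I * t)⁻¹ * (m + Complex.I * t)⁻¹) := by
        field_simp
        ring
      have := geom_sum₂_recursion hpq2 w
      rw [map_pow, hq, hpq]
      field_simp
      field_simp at this
      linear_combination this
    have i1 := integrable_inv_sub_I_mul_pow hm w
    have i2 : Integrable fun t : ℝ => starRingEnd ℂ (((m - Complex.I * t)⁻¹ : ℂ) ^ (w + 2)) :=
      (Complex.conjCLE.toContinuousLinearMap.integrable_comp i1)
    have i12 : Integrable fun t : ℝ => (((m - Complex.I * t)⁻¹ : ℂ) ^ (w + 2)
        + starRingEnd ℂ (((m - Complex.I * t)⁻¹ : ℂ) ^ (w + 2))) / (2 * m) :=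
      (i1.add i2).div_const _
    simp only [e]
    refine ⟨i12.add (ih.1.div_const _), ?_⟩
    rw [integral_add i12 (ih.1.div_const _), integral_div, integral_div,
      integral_add i1 i2, integral_conj, integral_inv_sub_I_mul_pow hm, ih.2]
    rw [map_zero, add_zero, zero_div, zero_add, pow_succ, div_div]

theorem integral_scaledKernel (w : ℕ) (Y : ℝ) {m : ℤ} (hm : m ≠ 0) :
    ∫ t, scaledKernel w Y m 0 t = (-Y) ^ w * (π * ((|(m : ℝ)|⁻¹ : ℝ) : ℂ) / m ^ w) := by
  rw [← (integral_geom_sum₂ hm w).2, ← integral_const_mul]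
  refine integral_congr_ae (Eventually.of_forall fun t => ?_)
  -- Since im + t = i(m - it), the ratio at ε = 0 is -Y/(m - it), and (-Y)^w factors out of the sum.
  have hB : ((((0 : ℝ) : ℂ) - Complex.I * Y) / (Complex.I * m + t) : ℂ)
      = (-Y : ℝ) * (m - Complex.I * t)⁻¹ := by
    have h1 := I_mul_add_ne_zero hm t
    have h2 := sub_I_mul_ne_zero hm t
    push_cast
    field_simp
    linear_combination (Y : ℂ) * t * Complex.I_sq
  simp only [scaledKernel, hB, map_mul, Complex.conj_ofReal]
  rw [Finset.mul_sum, Finset.mul_sum, Finset.mul_sum]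
  refine Finset.sum_congr rfl fun i hi => ?_
  have hi' := Nat.add_sub_cancel' (Nat.lt_succ_iff.mp (Finset.mem_range.mp hi))
  have : ((-Y : ℝ) : ℂ) ^ w = ((-Y : ℝ) : ℂ) ^ i * ((-Y : ℝ) : ℂ) ^ (w - i) := by
    rw [← pow_add, hi']
  rw [← Complex.ofReal_neg, this]
  ring

/-! ### Lattice series: convergence and termwise differentiation -/

theorem exists_mul_norm_le_norm_linForm (A : ℝ) {B : ℝ} (hB : 0 < B) :
    ∃ R > 0, ∀ z : ℂ, |z.re| ≤ A → B ≤ z.im → ∀ u : Fin 2 → ℤ, R * ‖u‖ ≤ ‖linForm u z‖ := by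
  refine ⟨EisensteinSeries.r ⟨⟨A, B⟩, hB⟩, EisensteinSeries.r_pos _, fun z hA hz u => ?_⟩
  by_cases hu : u = 0
  · simp [hu]
  refine le_trans ?_ (EisensteinSeries.r_mul_max_le ⟨z, hB.trans_le hz⟩ hu)
  gcongr
  exact EisensteinSeries.r_lower_bound_on_verticalStrip _ hB ⟨hA, hz⟩

theorem summable_inv_norm_pow {k : ℕ} (hk : 3 ≤ k) :
    Summable fun u : Fin 2 → ℤ => (‖u‖ ^ k)⁻¹ := by
  have := EisensteinSeries.summable_one_div_norm_rpow (k := k) (by exact_mod_cast hk)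
  refine this.congr fun u => ?_
  rw [Real.rpow_neg (norm_nonneg _), Real.rpow_natCast]

theorem inv_norm_linForm_pow_le {R : ℝ} (hR : 0 < R) {u : Fin 2 → ℤ} {z : ℂ}
    (h : R * ‖u‖ ≤ ‖linForm u z‖) {k : ℕ} (hk : k ≠ 0) :
    (‖linForm u z‖ ^ k)⁻¹ ≤ (R ^ k)⁻¹ * (‖u‖ ^ k)⁻¹ := by
  by_cases hu : u = 0
  · simp [hu, linForm, hk]
  rw [← mul_inv, ← mul_pow]
  have : 0 < ‖u‖ := norm_pos_iff.mpr hu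
  gcongr

section Series

variable {N : ℕ} (a : (Fin 2 → ZMod N) → ℂ)

/-- The Eisenstein series with coefficients `a (u mod N)`. -/
noncomputable def latticeSeries (k : ℕ) (z : ℂ) : ℂ :=
  ∑' u : Fin 2 → ℤ, a (redMod N u) / linForm u z ^ k

/-- The real analytic companion of `latticeSeries`. -/
noncomputable def kernelSeries (w : ℕ) (X Y : ℝ) (z : ℂ) : ℂ :=
  ∑' u : Fin 2 → ℤ, a (redMod N u) * eisKernel w X Y u z

variable {a}

theorem norm_latticeSeries_term_le (ha : ∀ v, ‖a v‖ ≤ 1) (k : ℕ) (u : Fin 2 → ℤ) (z : ℂ) :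
    ‖a (redMod N u) / linForm u z ^ k‖ ≤ (‖linForm u z‖ ^ k)⁻¹ := by
  rw [norm_div, norm_pow, div_eq_mul_inv]
  exact mul_le_of_le_one_left (by positivity) (ha _)

theorem norm_kernelSeries_term_le (ha : ∀ v, ‖a v‖ ≤ 1) (w : ℕ) (X Y : ℝ) (u : Fin 2 → ℤ) (z : ℂ) :
    ‖a (redMod N u) * eisKernel w X Y u z‖ ≤ |z.im| * ((w + 1) * ‖(X - z * Y : ℂ)‖ ^ w)
      * (‖linForm u z‖ ^ (w + 2))⁻¹ := by
  rw [norm_mul]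
  exact (mul_le_of_le_one_left (norm_nonneg _) (ha _)).trans (norm_eisKernel_le w X Y u z)

theorem summable_inv_norm_linForm_pow {k : ℕ} (hk : 3 ≤ k) {z : ℂ} (hz : 0 < z.im) :
    Summable fun u : Fin 2 → ℤ => (‖linForm u z‖ ^ k)⁻¹ := by
  obtain ⟨R, hR, h⟩ := exists_mul_norm_le_norm_linForm |z.re| hz
  refine Summable.of_nonneg_of_le (fun u => by positivity) (fun u =>
    inv_norm_linForm_pow_le hR (h z le_rfl le_rfl u) (by lia))
    ((summable_inv_norm_pow hk).mul_left _)

theorem summable_latticeSeries (ha : ∀ v, ‖a v‖ ≤ 1) {k : ℕ} (hk : 3 ≤ k) {z : ℂ}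
    (hz : 0 < z.im) : Summable fun u : Fin 2 → ℤ => a (redMod N u) / linForm u z ^ k :=
  Summable.of_norm_bounded (summable_inv_norm_linForm_pow hk hz)
    fun u => norm_latticeSeries_term_le ha k u z

theorem summable_kernelSeries (ha : ∀ v, ‖a v‖ ≤ 1) {w : ℕ} (hw : 1 ≤ w) (X Y : ℝ) {z : ℂ}
    (hz : 0 < z.im) : Summable fun u : Fin 2 → ℤ => a (redMod N u) * eisKernel w X Y u z :=
  Summable.of_norm_bounded ((summable_inv_norm_linForm_pow (k := w + 2) (by lia) hz).mul_left _)
    fun u => norm_kernelSeries_term_le ha w X Y u z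

theorem differentiableOn_latticeSeries (ha : ∀ v, ‖a v‖ ≤ 1) {k : ℕ} (hk : 3 ≤ k) :
    DifferentiableOn ℂ (latticeSeries a k) {z | 0 < z.im} := by
  intro z hz
  obtain ⟨R, hR, h⟩ := exists_mul_norm_le_norm_linForm (|z.re| + 1) (half_pos hz)
  set U : Set ℂ := {ζ | |ζ.re| < |z.re| + 1 ∧ z.im / 2 < ζ.im} with hU
  have hUo : IsOpen U :=
    (isOpen_lt Complex.continuous_re.abs continuous_const).inter
      (isOpen_lt continuous_const Complex.continuous_im)
  have hzU : z ∈ U := ⟨by simp, half_lt_self hz⟩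
  have : DifferentiableOn ℂ (latticeSeries a k) U := by
    refine Complex.differentiableOn_tsum_of_summable_norm
      ((summable_inv_norm_pow hk).mul_left (R ^ k)⁻¹) (fun u => ?_) hUo (fun u ζ hζ => ?_)
    · by_cases hu : u = 0
      · simp only [hu, linForm, Pi.zero_apply, Int.cast_zero, zero_mul, zero_add]
        exact differentiableOn_const _
      · refine DifferentiableOn.div (differentiableOn_const _) ?_ fun ζ hζ =>
          pow_ne_zero _ (linForm_ne_zero hu ((half_pos hz).trans hζ.2))
        unfold linForm
        fun_prop
    · exact (norm_latticeSeries_term_le ha k u ζ).trans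
        (inv_norm_linForm_pow_le hR (h ζ hζ.1.le hζ.2.le u) (by lia))
  exact ((this z hzU).differentiableAt (hUo.mem_nhds hzU)).differentiableWithinAt

/-- The coefficients are complex, so the series with conjugated denominators alone is not visibly a
conjugate. The substitution u ↦ -u makes it one, up to (-1)^k. -/
theorem latticeSeries_conj (k : ℕ) (hneg : ∀ v, a (-v) = starRingEnd ℂ (a v)) (z : ℂ) :
    ∑' u : Fin 2 → ℤ, a (redMod N u) / (starRingEnd ℂ (linForm u z)) ^ k
      = (-1) ^ k * starRingEnd ℂ (latticeSeries a k z) := by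
  rw [latticeSeries, Complex.conj_tsum, ← tsum_mul_left, ← (Equiv.neg _).tsum_eq]
  refine tsum_congr fun u => ?_
  have h1 : redMod N (-u) = -redMod N u := by ext i; simp [redMod]
  have h2 : linForm (-u) z = -linForm u z := by simp [linForm]; ring
  rw [Equiv.neg_apply, h1, h2, hneg, map_div₀, map_pow, map_neg, neg_pow]
  rcases neg_one_pow_eq_or ℂ k with h | h <;> rw [h] <;> simp [div_neg]

theorem hasDerivAt_kernelSeries (ha : ∀ v, ‖a v‖ ≤ 1)
    (hneg : ∀ v, a (-v) = starRingEnd ℂ (a v)) {w : ℕ} (hw : 1 ≤ w) (X Y x : ℝ) {y : ℝ}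
    (hy : 0 < y) :
    HasDerivAt (fun y : ℝ => kernelSeries a w X Y (x + y * Complex.I))
      ((w + 1) / 2 * ((X - (x + y * Complex.I) * Y) ^ w * latticeSeries a (w + 2) (x + y * Complex.I)
        + (-1) ^ w * starRingEnd ℂ ((X - (x + y * Complex.I) * Y) ^ w
          * latticeSeries a (w + 2) (x + y * Complex.I)))) y := by
  have him : ∀ y : ℝ, (x + y * Complex.I : ℂ).im = y := by simp
  have hre : ∀ y : ℝ, (x + y * Complex.I : ℂ).re = x := by simp
  obtain ⟨R, hR, h⟩ := exists_mul_norm_le_norm_linForm |x| (half_pos hy)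
  set t : Set ℝ := Set.Ioo (y / 2) (2 * y) with ht
  have hyt : y ∈ t := ⟨by linarith, by linarith⟩
  have hderiv : ∀ (u : Fin 2 → ℤ) (s : ℝ), s ∈ t →
      HasDerivAt (fun s : ℝ => a (redMod N u) * eisKernel w X Y u (x + s * Complex.I))
        (a (redMod N u) * ((((w + 1) * ((X - (x + s * Complex.I) * Y) ^ w
        / linForm u (x + s * Complex.I) ^ (w + 2)).re : ℝ)) : ℂ)) s := by
    intro u s hs
    have hs0 : 0 < s := (half_pos hy).trans hs.1
    by_cases hu : u = 0
    · have e : (fun s : ℝ => a (redMod N u) * eisKernel w X Y u (x + s * Complex.I)) =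
          fun _ => 0 := by
        funext s; simp [hu, eisKernel, linForm]
      rw [e]
      refine (hasDerivAt_const s (0 : ℂ)).congr_deriv ?_
      simp [hu, linForm]
    · exact (hasDerivAt_eisKernel w X Y u x s
        (linForm_ne_zero hu (by rw [him]; exact hs0))).const_mul _
  set M : ℝ := |X| + (|x| + 2 * y) * |Y| with hM
  have hMb : ∀ s ∈ t, ‖(X - (x + s * Complex.I) * Y : ℂ)‖ ≤ M := by
    intro s hs
    have hs0 : 0 < s := (half_pos hy).trans hs.1
    refine (norm_sub_le _ _).trans ?_
    rw [hM, norm_mul, Complex.norm_real, Complex.norm_real, Real.norm_eq_abs, Real.norm_eq_abs]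
    gcongr
    refine (norm_add_le _ _).trans ?_
    rw [norm_mul, Complex.norm_I, mul_one, Complex.norm_real, Complex.norm_real, Real.norm_eq_abs,
      Real.norm_eq_abs, abs_of_pos hs0]
    linarith [hs.2]
  have key := hasDerivAt_tsum_of_isPreconnected
    (u := fun u : Fin 2 → ℤ => (w + 1) * M ^ w * ((R ^ (w + 2))⁻¹ * (‖u‖ ^ (w + 2))⁻¹))
    (((summable_inv_norm_pow (k := w + 2) (by lia)).mul_left _).mul_left _)
    isOpen_Ioo isPreconnected_Ioo hderiv (fun u s hs => ?_) hyt
    (summable_kernelSeries ha hw X Y (by rw [him]; exact hy)) hyt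
  · refine key.congr_deriv ?_
    set z : ℂ := x + y * Complex.I with hz
    have hz0 : 0 < z.im := by rw [hz, him]; exact hy
    -- The real part is taken of A^w/q^(w+2) without its coefficient, hence the split into a
    -- holomorphic half and a half with conjugated denominators.
    have hterm : ∀ u : Fin 2 → ℤ, a (redMod N u) * ((((w + 1) * ((X - z * Y) ^ w
        / linForm u z ^ (w + 2)).re : ℝ)) : ℂ)
        = (w + 1) / 2 * ((X - z * Y) ^ w * (a (redMod N u) / linForm u z ^ (w + 2)))
          + (w + 1) / 2 * (starRingEnd ℂ ((X - z * Y) ^ w)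
            * (a (redMod N u) / (starRingEnd ℂ (linForm u z)) ^ (w + 2))) := by
      intro u
      have hre2 : ∀ a : ℂ, (a.re : ℂ) = (a + starRingEnd ℂ a) / 2 := by
        intro a
        rw [Complex.add_conj]
        push_cast
        ring
      rw [Complex.ofReal_mul, hre2, map_div₀, map_pow _ (linForm u z)]
      push_cast
      ring
    have s1 := summable_latticeSeries ha (k := w + 2) (by lia) hz0
    have s2 : Summable fun u : Fin 2 → ℤ =>
        a (redMod N u) / (starRingEnd ℂ (linForm u z)) ^ (w + 2) := by
      refine s1.norm.of_norm_bounded fun u => le_of_eq ?_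
      simp
    simp only [hterm]
    rw [((s1.mul_left _).mul_left _).tsum_add ((s2.mul_left _).mul_left _)]
    rw [tsum_mul_left, tsum_mul_left, tsum_mul_left, tsum_mul_left, latticeSeries_conj _ hneg,
      ← latticeSeries, map_mul]
    ring
  · have hs0 : 0 < s := (half_pos hy).trans hs.1
    have hb := inv_norm_linForm_pow_le hR
      (h (x + s * Complex.I) (by rw [hre]) (by rw [him]; exact hs.1.le) u) (k := w + 2) (by lia)
    rw [norm_mul, Complex.norm_real, norm_mul, Real.norm_of_nonneg (by positivity : (0:ℝ) ≤ w + 1)]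
    refine (mul_le_of_le_one_left (by positivity) (ha _)).trans ?_
    rw [mul_assoc]
    gcongr
    refine (Complex.abs_re_le_norm _).trans ?_
    rw [norm_div, norm_pow, norm_pow, div_eq_mul_inv]
    gcongr
    exact hMb s hs

/-- The shear (m, n) ↦ (m, n - Nm) absorbs the translation and is trivial modulo N. -/
theorem latticeSeries_add_period (k : ℕ) (z : ℂ) :
    latticeSeries a k (z + N) = latticeSeries a k z := by
  let e : (Fin 2 → ℤ) ≃ (Fin 2 → ℤ) :=
    { toFun := fun u => ![u 0, u 1 - N * u 0]
      invFun := fun u => ![u 0, u 1 + N * u 0]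
      left_inv := fun u => by ext i; fin_cases i <;> simp
      right_inv := fun u => by ext i; fin_cases i <;> simp }
  rw [latticeSeries, ← e.tsum_eq, latticeSeries]
  refine tsum_congr fun u => ?_
  have h1 : redMod N (e u) = redMod N u := by
    ext i; fin_cases i <;> simp [e, redMod]
  have h2 : linForm (e u) (z + N) = linForm u z := by
    simp [e, linForm]; ring
  rw [h1, h2]

end Series

/-! ### Rows, constant term and decay at the cusp -/

theorem tsum_eq_add_tsum_rows {f : (Fin 2 → ℤ) → ℂ} (hf : Summable f) :
    ∑' u, f u = ∑' n : ℤ, f ![0, n] + ∑' m : ℤ, if m = 0 then 0 else ∑' n : ℤ, f ![m, n] := by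
  have h1 : Summable fun p : ℤ × ℤ => f ![p.1, p.2] := by
    have := (finTwoArrowEquiv ℤ).symm.summable_iff.mpr hf
    simpa [Function.comp_def] using this
  rw [← (finTwoArrowEquiv ℤ).symm.tsum_eq]
  simp only [finTwoArrowEquiv_symm_apply]
  rw [h1.tsum_prod, h1.prod.tsum_eq_add_tsum_ite 0]

theorem summable_int_inv_abs_pow {p : ℕ} (hp : 2 ≤ p) :
    Summable fun m : ℤ => (|(m : ℝ)| ^ p)⁻¹ := by
  have := (Real.summable_one_div_int_pow (p := p)).mpr (by lia)
  refine this.norm.congr fun m => ?_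
  simp

theorem redMod_cons (N : ℕ) (m n : ℤ) : redMod N ![m, n] = ![(m : ZMod N), (n : ZMod N)] := by
  ext i; fin_cases i <;> simp [redMod]

theorem norm_linForm_sq {h : ℝ} (hh : 0 < h) (m n : ℤ) (x : ℝ) :
    ‖linForm ![m, n] (x + (h⁻¹ : ℝ) * Complex.I)‖ ^ 2
      = (h⁻¹) ^ 2 * ((m : ℝ) ^ 2 + (h * (n + m * x)) ^ 2) := by
  rw [← Complex.normSq_eq_norm_sq, Complex.normSq_apply]
  simp [linForm]
  field_simp
  ring

section Series

variable {N : ℕ} (a : (Fin 2 → ZMod N) → ℂ)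

/-- The constant term of `latticeSeries`. -/
noncomputable def latticeConst (k : ℕ) : ℂ := ∑' n : ℤ, a ![0, (n : ZMod N)] / (n : ℂ) ^ k

/-- The function on the upper half plane given by `latticeSeries`. -/
noncomputable def latticeFun (k : ℕ) (τ : UpperHalfPlane) : ℂ := latticeSeries a k τ

variable {a}

/-- The row m = 0 is the constant term. This crude decay suffices: periodicity and holomorphy later
upgrade it to exponential decay. -/
theorem exists_norm_latticeSeries_sub_le (ha : ∀ v, ‖a v‖ ≤ 1) {k : ℕ} (hk : 3 ≤ k) :
    ∃ C : ℝ, ∀ z : ℂ, 1 ≤ z.im → ‖latticeSeries a k z - latticeConst a k‖ ≤ (z.im)⁻¹ * C := by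
  refine ⟨∑' m : ℤ, 3 * π * (|(m : ℝ)| ^ 2)⁻¹, fun z hz => ?_⟩
  have hz0 : 0 < z.im := zero_lt_one.trans_le hz
  set h : ℝ := (z.im)⁻¹ with hh
  have hh0 : 0 < h := inv_pos.mpr hz0
  have hh1 : h ≤ 1 := inv_le_one_of_one_le₀ hz
  have hzx : z = z.re + (h⁻¹ : ℝ) * Complex.I := by
    rw [hh, inv_inv]
    exact (Complex.re_add_im z).symm
  have hrow0 : ∑' n : ℤ, a (redMod N ![0, n]) / linForm ![0, n] z ^ k = latticeConst a k := by
    refine tsum_congr fun n => ?_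
    simp [redMod_cons, linForm]
  rw [latticeSeries, tsum_eq_add_tsum_rows (summable_latticeSeries ha hk hz0), hrow0,
    add_sub_cancel_left, ← tsum_mul_left]
  refine tsum_of_norm_bounded (((summable_int_inv_abs_pow le_rfl).mul_left _).mul_left h).hasSum
    fun m => ?_
  split_ifs with hm
  · simp only [norm_zero]
    positivity
  have hm' : 0 < |(m : ℝ)| := by positivity
  have hm1 : 1 ≤ |(m : ℝ)| := by
    have := one_le_sq_of_ne_zero hm
    rwa [one_le_sq_iff_one_le_abs] at this
  obtain ⟨hs, hle⟩ := tsum_lattice_inv_sq_add_sq_le hm hh0 hh1 (m * z.re)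
  have hterm : ∀ n : ℤ, ‖a (redMod N ![m, n]) / linForm ![m, n] z ^ k‖ ≤
      h * |(m : ℝ)|⁻¹ * (h * ((m : ℝ) ^ 2 + (h * (n + m * z.re)) ^ 2)⁻¹) := by
    intro n
    refine (norm_latticeSeries_term_le ha k _ z).trans ?_
    set q := ‖linForm ![m, n] z‖ with hq
    have hq2 : q ^ 2 = (h⁻¹) ^ 2 * ((m : ℝ) ^ 2 + (h * (n + m * z.re)) ^ 2) := by
      rw [hq, hzx, norm_linForm_sq hh0]
      simp
    have hqm : |(m : ℝ)| ≤ q := by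
      have h2 : |(m : ℝ)| ^ 2 ≤ q ^ 2 := by
        rw [hq2, sq_abs]
        have : 1 ≤ (h⁻¹) ^ 2 := one_le_pow₀ ((one_le_inv₀ hh0).mpr hh1)
        nlinarith [sq_nonneg (m : ℝ), sq_nonneg (h * (n + m * z.re))]
      exact (pow_le_pow_iff_left₀ (abs_nonneg _) (norm_nonneg _) two_ne_zero).mp h2
    -- Of three factors 1/q, one is bounded by 1/|m| to sum over rows; the other two give h times a
    -- Riemann sum of mesh h.
    calc (q ^ k)⁻¹ ≤ (q ^ 3)⁻¹ := by
          have : 1 ≤ q := hm1.trans hqm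
          gcongr
      _ = q⁻¹ * (q ^ 2)⁻¹ := by rw [← mul_inv]; ring_nf
      _ ≤ |(m : ℝ)|⁻¹ * (q ^ 2)⁻¹ := by gcongr
      _ = _ := by
          rw [hq2, mul_inv, inv_pow, inv_inv]
          ring
  refine (tsum_of_norm_bounded (hs.mul_left _).hasSum hterm).trans ?_
  rw [tsum_mul_left]
  refine (mul_le_mul_of_nonneg_left hle (by positivity)).trans (le_of_eq ?_)
  field_simp

theorem tendsto_latticeFun (ha : ∀ v, ‖a v‖ ≤ 1) {k : ℕ} (hk : 3 ≤ k) :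
    Tendsto (latticeFun a k) UpperHalfPlane.atImInfty (𝓝 (latticeConst a k)) := by
  obtain ⟨C, hC⟩ := exists_norm_latticeSeries_sub_le ha hk
  rw [tendsto_iff_norm_sub_tendsto_zero]
  have h1 : Tendsto (fun τ : UpperHalfPlane => (τ.im)⁻¹ * C) UpperHalfPlane.atImInfty (𝓝 0) := by
    have : Tendsto UpperHalfPlane.im UpperHalfPlane.atImInfty atTop := tendsto_comap
    simpa using (this.inv_tendsto_atTop).mul_const C
  refine squeeze_zero' (Eventually.of_forall fun _ => norm_nonneg _) ?_ h1
  have : ∀ᶠ τ : UpperHalfPlane in UpperHalfPlane.atImInfty, 1 ≤ τ.im :=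
    tendsto_comap.eventually (eventually_ge_atTop 1)
  filter_upwards [this] with τ hτ
  exact hC τ hτ

theorem valueAtInfty_latticeFun (ha : ∀ v, ‖a v‖ ≤ 1) {k : ℕ} (hk : 3 ≤ k) :
    UpperHalfPlane.valueAtInfty (latticeFun a k) = latticeConst a k :=
  (tendsto_latticeFun ha hk).limUnder_eq

theorem add_mul_I_mem (τ : UpperHalfPlane) {t : ℝ} (ht : 0 ≤ t) :
    0 < ((τ : ℂ) + t * Complex.I).im := by
  have := τ.im_pos
  simp
  linarith

theorem latticeFun_ofComplex (k : ℕ) {z : ℂ} (hz : 0 < z.im) :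
    latticeFun a k (UpperHalfPlane.ofComplex z) = latticeSeries a k z := by
  rw [UpperHalfPlane.ofComplex_apply_of_im_pos hz]
  rfl

theorem isBigO_latticeFun_sub [NeZero N] (ha : ∀ v, ‖a v‖ ≤ 1) {k : ℕ} (hk : 3 ≤ k) :
    (fun τ => latticeFun a k τ - latticeConst a k) =O[UpperHalfPlane.atImInfty]
      fun τ => Real.exp (-2 * π * τ.im / N) := by
  have hN : (0 : ℝ) < N := Nat.cast_pos.mpr (NeZero.pos N)
  rw [← valueAtInfty_latticeFun ha hk]
  refine UpperHalfPlane.exp_decay_sub_atImInfty hN ?_ ?_ ?_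
  · intro z
    by_cases hz : 0 < z.im
    · have hz' : 0 < (z + (N : ℝ)).im := by simpa using hz
      simp only [Function.comp_apply]
      rw [latticeFun_ofComplex k hz, latticeFun_ofComplex k hz']
      exact_mod_cast latticeSeries_add_period k z
    -- Periodicity is required on all of ℂ; off the upper half plane `ofComplex` takes a constant
    -- default value.
    · have hz' : ¬ 0 < (z + (N : ℝ)).im := by simpa using hz
      simp only [Function.comp_apply]
      rw [UpperHalfPlane.ofComplex_apply_of_im_nonpos (not_lt.mp hz),
        UpperHalfPlane.ofComplex_apply_of_im_nonpos (not_lt.mp hz')]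
  · rw [UpperHalfPlane.mdifferentiable_iff]
    refine (differentiableOn_latticeSeries ha hk).congr fun z hz => ?_
    exact latticeFun_ofComplex k hz
  · exact ((tendsto_latticeFun ha hk).isBigO_one ℝ)

theorem integrableOn_latticeFun [NeZero N] (ha : ∀ v, ‖a v‖ ≤ 1) {k : ℕ} (hk : 3 ≤ k)
    (p : ℕ) (τ : UpperHalfPlane) :
    IntegrableOn (fun t : ℝ => (latticeFun a k (UpperHalfPlane.ofComplex ((τ : ℂ) + t * Complex.I))
      - latticeConst a k) * ((τ : ℂ) + t * Complex.I) ^ p * Complex.I) (Set.Ioi 0) := by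
  have hN : (0 : ℝ) < N := Nat.cast_pos.mpr (NeZero.pos N)
  -- Half the decay rate 2π/N: the other half absorbs the polynomial factor.
  set b : ℝ := π / N with hb
  have hb0 : 0 < b := by positivity
  have hcont : ContinuousOn (fun t : ℝ =>
      (latticeFun a k (UpperHalfPlane.ofComplex ((τ : ℂ) + t * Complex.I))
        - latticeConst a k) * ((τ : ℂ) + t * Complex.I) ^ p * Complex.I) (Set.Ici 0) := by
    have h1 : ContinuousOn (fun t : ℝ => latticeSeries a k ((τ : ℂ) + t * Complex.I))
        (Set.Ici 0) := by
      refine (differentiableOn_latticeSeries ha hk).continuousOn.comp (by fun_prop) ?_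
      intro t ht
      exact add_mul_I_mem τ ht
    have h2 : ContinuousOn (fun t : ℝ => latticeFun a k
        (UpperHalfPlane.ofComplex ((τ : ℂ) + t * Complex.I))) (Set.Ici 0) :=
      h1.congr fun t ht => latticeFun_ofComplex k (add_mul_I_mem τ ht)
    exact ((h2.sub continuousOn_const).mul (by fun_prop)).mul continuousOn_const
  refine (integrable_norm_iff ((hcont.mono Set.Ioi_subset_Ici_self).aestronglyMeasurable
    measurableSet_Ioi)).mp
    (integrable_of_isBigO_exp_neg hb0 hcont.norm (Asymptotics.IsBigO.norm_left ?_))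
  · have hlim : Tendsto (fun t : ℝ => UpperHalfPlane.ofComplex ((τ : ℂ) + t * Complex.I)) atTop
        UpperHalfPlane.atImInfty := by
      refine UpperHalfPlane.tendsto_comap_im_ofComplex.comp (tendsto_comap_iff.mpr ?_)
      have : (Complex.im ∘ fun t : ℝ => (τ : ℂ) + t * Complex.I) = fun t => τ.im + t := by
        funext t; simp
      rw [this]
      exact tendsto_atTop_add_const_left _ _ tendsto_id
    have h1 := (isBigO_latticeFun_sub ha hk).comp_tendsto hlim
    have h2 : (fun t : ℝ => Real.exp (-2 * π *
        (UpperHalfPlane.ofComplex ((τ : ℂ) + t * Complex.I)).im / N)) =O[atTop]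
        fun t : ℝ => Real.exp (-(2 * b) * t) := by
      refine Asymptotics.IsBigO.of_bound 1 ?_
      filter_upwards [eventually_ge_atTop 0] with t ht
      rw [UpperHalfPlane.ofComplex_apply_of_im_pos (add_mul_I_mem τ ht), one_mul,
        Real.norm_of_nonneg (Real.exp_pos _).le, Real.norm_of_nonneg (Real.exp_pos _).le]
      refine Real.exp_le_exp.mpr ?_
      have := τ.im_pos
      simp only [UpperHalfPlane.im, Complex.add_im, Complex.mul_im,
        Complex.ofReal_re, Complex.I_im, mul_one, Complex.ofReal_im, Complex.I_re, mul_zero,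
        add_zero, hb]
      rw [div_le_iff₀ hN]
      field_simp
      have h3 := mul_pos Real.pi_pos this
      simp only [UpperHalfPlane.im] at this
      linarith
    have h3 : (fun t : ℝ => ((τ : ℂ) + t * Complex.I) ^ p) =O[atTop] fun t : ℝ => t ^ p := by
      refine Asymptotics.IsBigO.pow ?_ p
      refine Asymptotics.IsBigO.of_bound (‖(τ : ℂ)‖ + 1) ?_
      filter_upwards [eventually_ge_atTop 1] with t ht
      refine (norm_add_le _ _).trans ?_
      rw [norm_mul, Complex.norm_I, mul_one, Complex.norm_real]
      have : 1 ≤ ‖t‖ := by rw [Real.norm_of_nonneg (by linarith)]; exact ht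
      nlinarith [norm_nonneg (τ : ℂ)]
    have h4 : (fun t : ℝ => t ^ p) =O[atTop] fun t : ℝ => Real.exp (b * t) :=
      (isLittleO_pow_exp_pos_mul_atTop p hb0).isBigO
    have h5 : (fun _ : ℝ => Complex.I) =O[atTop] fun _ : ℝ => (1 : ℝ) :=
      Asymptotics.isBigO_const_const _ one_ne_zero _
    have h6 : (fun x : ℝ => Real.exp (-(2 * b) * x) * Real.exp (b * x) * 1)
        = fun x => Real.exp (-b * x) := by
      funext x
      rw [← Real.exp_add, mul_one]
      ring_nf
    rw [← h6]
    exact ((h1.trans h2).mul (h3.trans h4)).mul h5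

end Series

/-! ### The row m = 0 and the regularising term -/

/-- Homogeneity of degree -(w + 2) in u collects the row m = 0 into the constant term times a single
kernel. -/
theorem eisKernel_zero_row (w : ℕ) (X Y : ℝ) (n : ℤ) (z : ℂ) :
    eisKernel w X Y ![0, n] z = ((n : ℂ) ^ (w + 2))⁻¹ * eisKernel w X Y ![0, 1] z := by
  by_cases hn : n = 0
  · simp [hn, eisKernel, linForm]
  have hnc : (n : ℂ) ≠ 0 := by exact_mod_cast hn
  have h1 : linForm ![0, n] z = n := by simp [linForm]
  have h2 : linForm ![0, 1] z = 1 := by simp [linForm]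
  have hsum : ∑ i ∈ Finset.range (w + 1), ((X - z * Y) / n : ℂ) ^ i
      * (starRingEnd ℂ ((X - z * Y) / n)) ^ (w - i) = ((n : ℂ) ^ w)⁻¹ *
      ∑ i ∈ Finset.range (w + 1), ((X - z * Y) / 1 : ℂ) ^ i
      * (starRingEnd ℂ ((X - z * Y) / 1)) ^ (w - i) := by
    rw [Finset.mul_sum]
    refine Finset.sum_congr rfl fun i hi => ?_
    have hi' := Nat.add_sub_cancel' (Nat.lt_succ_iff.mp (Finset.mem_range.mp hi))
    have : (n : ℂ) ^ w = (n : ℂ) ^ i * (n : ℂ) ^ (w - i) := by rw [← pow_add, hi']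
    rw [this, map_div₀, map_intCast, div_one, div_pow, div_pow]
    field_simp
  rw [eisKernel, eisKernel, h1, h2, hsum, Complex.normSq_intCast, map_one]
  push_cast
  field_simp
  ring

/-- The antiderivative `∫_0^z (X - ζ Y)^w dζ`, expanded in powers of `z`. -/
noncomputable def eichlerPrimitive (w : ℕ) (X Y : ℝ) (z : ℂ) : ℂ :=
  ∑ p ∈ Finset.range (w + 1), (w.choose p : ℂ) * (-1) ^ p * X ^ (w - p) * Y ^ p
    * (z ^ (p + 1) / (p + 1))

theorem sum_choose_mul_pow (w : ℕ) (X Y : ℝ) (z : ℂ) :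
    ∑ p ∈ Finset.range (w + 1), (w.choose p : ℂ) * (-1) ^ p * X ^ (w - p) * Y ^ p * z ^ p
      = (X - z * Y) ^ w := by
  rw [sub_eq_neg_add, add_pow]
  refine Finset.sum_congr rfl fun p _ => ?_
  rw [neg_pow (z * Y : ℂ), mul_pow]
  ring

theorem hasDerivAt_eichlerPrimitive (w : ℕ) (X Y x y : ℝ) :
    HasDerivAt (fun y : ℝ => eichlerPrimitive w X Y (x + y * Complex.I))
      (Complex.I * (X - (x + y * Complex.I) * Y) ^ w) y := by
  have hz : HasDerivAt (fun y : ℝ => (x + y * Complex.I : ℂ)) Complex.I y :=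
    (((Complex.ofRealCLM.hasDerivAt (x := y)).mul_const Complex.I).const_add
      (x : ℂ)).congr_deriv (by simp)
  have := HasDerivAt.fun_sum (u := Finset.range (w + 1)) fun p _ =>
    ((hz.pow (p + 1)).div_const ((p : ℂ) + 1)).const_mul
      ((w.choose p : ℂ) * (-1) ^ p * X ^ (w - p) * Y ^ p)
  refine this.congr_deriv ?_
  rw [← sum_choose_mul_pow, Finset.mul_sum]
  refine Finset.sum_congr rfl fun p _ => ?_
  have : (p + 1 : ℂ) ≠ 0 := by exact_mod_cast Nat.succ_ne_zero p
  simp only [Nat.add_sub_cancel]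
  push_cast
  field_simp

/-- Both sides vanish at y = 0 and have the same derivative in y. This matches the row m = 0 with
the term -a₀ τ^(p+1)/(p+1) of the regularised integral. -/
theorem eisKernel_zero_one (w : ℕ) (X Y x y : ℝ) :
    eisKernel w X Y ![0, 1] (x + y * Complex.I)
      = (w + 1) * ((eichlerPrimitive w X Y (x + y * Complex.I)).im : ℂ) := by
  have hq : ∀ z, linForm ![0, 1] z = 1 := fun z => by simp [linForm]
  have hd : ∀ y : ℝ, HasDerivAt (fun y : ℝ => eisKernel w X Y ![0, 1] (x + y * Complex.I)
      - (w + 1) * ((eichlerPrimitive w X Y (x + y * Complex.I)).im : ℂ)) 0 y := by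
    intro y
    have h1 := hasDerivAt_eisKernel w X Y ![0, 1] x y (by rw [hq]; exact one_ne_zero)
    have h2 := (Complex.ofRealCLM.hasFDerivAt.comp_hasDerivAt y
      (Complex.imCLM.hasFDerivAt.comp_hasDerivAt y
      (hasDerivAt_eichlerPrimitive w X Y x y))).const_mul (w + 1 : ℂ)
    refine (h1.sub h2).congr_deriv ?_
    rw [hq]
    simp
  have hc := is_const_of_deriv_eq_zero (fun y => (hd y).differentiableAt) (fun y => (hd y).deriv) y 0
  have h0 : (eichlerPrimitive w X Y (x + (0 : ℝ) * Complex.I)).im = 0 := by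
    have : eichlerPrimitive w X Y (x + (0 : ℝ) * Complex.I) = ((∑ p ∈ Finset.range (w + 1),
        (w.choose p : ℝ) * (-1) ^ p * X ^ (w - p) * Y ^ p * (x ^ (p + 1) / (p + 1)) : ℝ) : ℂ) := by
      simp [eichlerPrimitive]
    rw [this, Complex.ofReal_im]
  rw [h0] at hc
  have h3 : eisKernel w X Y ![0, 1] (x + (0 : ℝ) * Complex.I) = 0 := by
    simp [eisKernel]
  rw [h3] at hc
  simpa [sub_eq_zero] using hc

/-! ### The limit at the cusp and the real part of the Eichler integral -/

section Series

variable {N : ℕ} (a : (Fin 2 → ZMod N) → ℂ)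

/-- The limit at `i∞` of the part of `kernelSeries` with `m ≠ 0`. -/
noncomputable def kernelLimit [NeZero N] (w : ℕ) (Y : ℝ) : ℂ :=
  ∑' m : ℤ, (∑ j : ZMod N, a ![(m : ZMod N), j]) / N
    * ((-Y) ^ w * (π * ((|(m : ℝ)|⁻¹ : ℝ) : ℂ) / m ^ w))

variable {a}

/-- Each row converges as a periodic Riemann sum, and the rows are dominated by a multiple of
|m|^(-(w+1)), summable because w ≥ 1. -/
theorem tendsto_kernelSeries_sub [NeZero N] (ha : ∀ v, ‖a v‖ ≤ 1) {w : ℕ} (hw : 1 ≤ w)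
    (X Y x : ℝ) :
    Tendsto (fun y : ℝ => kernelSeries a w X Y (x + y * Complex.I)
      - latticeConst a (w + 2) * eisKernel w X Y ![0, 1] (x + y * Complex.I)) atTop
      (𝓝 (kernelLimit a w Y)) := by
  have hlim : Tendsto (fun h : ℝ => ∑' m : ℤ, if m = 0 then 0 else ∑' n : ℤ,
      a ![(m : ZMod N), (n : ZMod N)]
        * (h * scaledKernel w Y m (h * (X - x * Y)) (h * (n + m * x)))) (𝓝[>] 0)
      (𝓝 (kernelLimit a w Y)) := by
    refine tendsto_tsum_of_dominated_convergence
      (bound := fun m : ℤ => (w + 1) * (1 + |Y|) ^ w * (3 * π) * (|(m : ℝ)| ^ (w + 1))⁻¹)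
      ((summable_int_inv_abs_pow (by lia)).mul_left _) (fun m => ?_) ?_
    -- The term m = 0 of `kernelLimit` is zero by the convention `0⁻¹ = 0`.
    · by_cases hm : m = 0
      · simp [hm]
      simp only [hm, if_false]
      rw [← integral_scaledKernel w Y hm]
      refine tendsto_lattice_sum_periodic (fun j => a ![(m : ZMod N), j])
        (continuous_scaledKernel w Y hm)
        (C := (w + 1) * (1 + |Y|) ^ w * (|(m : ℝ)| ^ w)⁻¹) (fun ε t hε => ?_) _ _
      refine (norm_scaledKernel_le w Y hm hε t).trans ?_
      have := one_le_sq_of_ne_zero hm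
      gcongr
    · have e1 : ∀ᶠ h : ℝ in 𝓝[>] 0, 0 < h ∧ h ≤ 1 ∧ |h * (X - x * Y)| ≤ 1 := by
        have : Tendsto (fun h : ℝ => |h * (X - x * Y)|) (𝓝 0) (𝓝 0) := by
          have : Continuous fun h : ℝ => |h * (X - x * Y)| := by fun_prop
          simpa using this.tendsto 0
        have h2 := (this.eventually (ge_mem_nhds (zero_lt_one))).filter_mono
          (nhdsWithin_le_nhds (s := Set.Ioi 0))
        filter_upwards [self_mem_nhdsWithin, h2, Ioo_mem_nhdsGT (zero_lt_one (α := ℝ))]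
          with h h1 h2 h3
        exact ⟨h1, h3.2.le, h2⟩
      filter_upwards [e1] with h hh m
      split_ifs with hm
      · simp only [norm_zero]; positivity
      obtain ⟨hs, hle⟩ := tsum_lattice_inv_sq_add_sq_le hm hh.1 hh.2.1 (m * x)
      refine (tsum_of_norm_bounded
        (hs.mul_left ((w + 1) * (1 + |Y|) ^ w * (|(m : ℝ)| ^ w)⁻¹)).hasSum fun n => ?_).trans ?_
      · rw [norm_mul, norm_mul, Complex.norm_real, Real.norm_of_nonneg hh.1.le]
        refine (mul_le_of_le_one_left (mul_nonneg hh.1.le (norm_nonneg _)) (ha _)).trans ?_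
        refine (mul_le_mul_of_nonneg_left (norm_scaledKernel_le w Y hm hh.2.2 _) hh.1.le).trans
          (le_of_eq ?_)
        ring
      · rw [tsum_mul_left]
        refine (mul_le_mul_of_nonneg_left hle (by positivity)).trans (le_of_eq ?_)
        rw [pow_succ, mul_inv]
        ring
  refine (hlim.comp tendsto_inv_atTop_nhdsGT_zero).congr' ?_
  filter_upwards [eventually_gt_atTop 0] with y hy
  have him : 0 < (x + y * Complex.I : ℂ).im := by simpa using hy
  rw [kernelSeries, tsum_eq_add_tsum_rows (summable_kernelSeries ha hw X Y him)]
  have hrow0 : ∑' n : ℤ, a (redMod N ![0, n]) * eisKernel w X Y ![0, n] (x + y * Complex.I)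
      = latticeConst a (w + 2) * eisKernel w X Y ![0, 1] (x + y * Complex.I) := by
    rw [latticeConst, ← tsum_mul_right]
    refine tsum_congr fun n => ?_
    rw [eisKernel_zero_row, redMod_cons, Int.cast_zero, div_eq_mul_inv, mul_assoc]
  rw [hrow0, add_sub_cancel_left, Function.comp_apply]
  refine tsum_congr fun m => ?_
  split_ifs with hm
  · rfl
  refine tsum_congr fun n => ?_
  have := eisKernel_eq_scaledKernel w X Y ![m, n] x (inv_pos.mpr hy)
  rw [inv_inv] at this
  rw [this, redMod_cons]
  rfl

theorem conj_latticeConst (hneg : ∀ v, a (-v) = starRingEnd ℂ (a v)) (k : ℕ) :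
    starRingEnd ℂ (latticeConst a k) = (-1) ^ k * latticeConst a k := by
  rw [latticeConst, Complex.conj_tsum, ← tsum_mul_left, ← (Equiv.neg ℤ).tsum_eq]
  refine tsum_congr fun n => ?_
  have h1 : (![0, ((-n : ℤ) : ZMod N)] : Fin 2 → ZMod N) = -![0, (n : ZMod N)] := by
    ext i; fin_cases i <;> simp
  rw [Equiv.neg_apply, h1, hneg, map_div₀, Complex.conj_conj, map_pow, map_intCast, Int.cast_neg,
    neg_pow]
  rcases neg_one_pow_eq_or ℂ k with h | h <;> rw [h] <;> simp [div_neg]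

/-- The real part of the regularised Eichler integral, evaluated at `(X, Y)`, in terms of the real
analytic series `kernelSeries`. -/
theorem re_sum_regIntegral [NeZero N] (ha : ∀ v, ‖a v‖ ≤ 1)
    (hneg : ∀ v, a (-v) = starRingEnd ℂ (a v)) {w : ℕ} (hw : 1 ≤ w) {α : ℂ}
    (hα : starRingEnd ℂ α = (-1) ^ (w + 1) * α) (X Y : ℝ) (τ : UpperHalfPlane) :
    (α * ∑ p ∈ Finset.range (w + 1), (w.choose p : ℂ) * (-1) ^ p * X ^ (w - p) * Y ^ p
      * regIntegral (latticeFun a (w + 2)) p τ).re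
      = (Complex.I * α / (w + 1) * kernelLimit a w Y).re
        - (Complex.I * α / (w + 1) * kernelSeries a w X Y τ).re := by
  have hk : 3 ≤ w + 2 := by lia
  have hw0 : (w + 1 : ℂ) ≠ 0 := by exact_mod_cast Nat.succ_ne_zero w
  set b := latticeConst a (w + 2) with hb
  set x := (τ : ℂ).re with hx
  have hτ : (τ : ℂ) = x + (τ.im : ℂ) * Complex.I := (Complex.re_add_im (τ : ℂ)).symm
  have hsq : ((-1 : ℂ) ^ w) * (-1) ^ w = 1 := by rw [← mul_pow]; simp
  -- As αb is purely imaginary, Re(αbP) involves only Im P, which is the quantity supplied by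
  -- `eisKernel_zero_one`.
  have hαb : (α * b).re = 0 := by
    have : starRingEnd ℂ (α * b) = -(α * b) := by
      rw [map_mul, hα, hb, conj_latticeConst hneg]
      linear_combination (-(α * latticeConst a (w + 2))) * hsq
    have := congrArg Complex.re this
    rw [Complex.conj_re, Complex.neg_re] at this
    linarith
  -- `J` is a primitive of Re `D`; subtracting the term in b cancels the row m = 0, so that `J` has
  -- a limit at infinity.
  set J : ℝ → ℝ := fun y =>
    (Complex.I * α / (w + 1) * kernelSeries a w X Y (x + y * Complex.I)).re
      - (α * b * eichlerPrimitive w X Y (x + y * Complex.I)).re with hJ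
  set D : ℝ → ℂ := fun y => α * ((latticeSeries a (w + 2) (x + y * Complex.I) - b)
      * (X - (x + y * Complex.I) * Y) ^ w * Complex.I) with hD
  have hderiv : ∀ y : ℝ, 0 < y → HasDerivAt J (D y).re y := by
    intro y hy
    have h1 := Complex.reCLM.hasFDerivAt.comp_hasDerivAt y
      ((hasDerivAt_kernelSeries ha hneg hw X Y x hy).const_mul (Complex.I * α / (w + 1)))
    have h2 := Complex.reCLM.hasFDerivAt.comp_hasDerivAt y
      ((hasDerivAt_eichlerPrimitive w X Y x y).const_mul (α * b))
    refine (h1.sub h2).congr_deriv ?_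
    simp only [Complex.reCLM_apply]
    set q := (X - (x + y * Complex.I) * Y : ℂ) ^ w
        * latticeSeries a (w + 2) (x + y * Complex.I) with hq
    -- The parity of α makes the holomorphic and antiholomorphic halves conjugate to each other.
    have e : Complex.I * α / (w + 1) * ((w + 1) / 2 * (q + (-1) ^ w * starRingEnd ℂ q))
        = (((Complex.I * α * q).re : ℝ) : ℂ) := by
      have h3 : (((Complex.I * α * q).re : ℝ) : ℂ)
          = (Complex.I * α * q + starRingEnd ℂ (Complex.I * α * q)) / 2 := by
        rw [Complex.add_conj]; push_cast; ring
      clear_value q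
      rw [h3, map_mul, map_mul, hα, Complex.conj_I, pow_succ]
      field_simp
    rw [e, Complex.ofReal_re, ← Complex.sub_re, hD, hq]
    congr 1
    ring
  have hlim : Tendsto J atTop (𝓝 (Complex.I * α / (w + 1) * kernelLimit a w Y).re) := by
    have h1 := (Complex.continuous_re.tendsto _).comp
      ((tendsto_kernelSeries_sub ha hw X Y x).const_mul (Complex.I * α / (w + 1)))
    refine h1.congr fun y => ?_
    simp only [Function.comp_apply, hJ]
    rw [mul_sub, Complex.sub_re]
    congr 1
    rw [eisKernel_zero_one, ← hb]
    set P := eichlerPrimitive w X Y (x + y * Complex.I)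
    have : Complex.I * α / (w + 1) * (b * ((w + 1) * (P.im : ℂ)))
        = (P.im : ℂ) * (Complex.I * (α * b)) := by field_simp
    rw [this, Complex.re_ofReal_mul, Complex.mul_re (α * b), Complex.mul_re Complex.I, hαb]
    simp
    ring
  have hF : ∀ p : ℕ, (fun t : ℝ => (latticeFun a (w + 2)
      (UpperHalfPlane.ofComplex ((τ : ℂ) + t * Complex.I)) - b)
      * ((τ : ℂ) + t * Complex.I) ^ p * Complex.I) =ᵐ[volume.restrict (Set.Ioi 0)]
      fun t : ℝ => (latticeSeries a (w + 2) (x + (τ.im + t : ℝ) * Complex.I) - b)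
      * (x + (τ.im + t : ℝ) * Complex.I) ^ p * Complex.I := by
    intro p
    filter_upwards [ae_restrict_mem measurableSet_Ioi] with t ht
    rw [latticeFun_ofComplex _ (add_mul_I_mem τ (le_of_lt ht))]
    have : (τ : ℂ) + t * Complex.I = x + (τ.im + t : ℝ) * Complex.I := by
      rw [hτ]; push_cast; ring
    rw [this]
  have hFint : ∀ p : ℕ, IntegrableOn (fun t : ℝ =>
      (latticeSeries a (w + 2) (x + (τ.im + t : ℝ) * Complex.I) - b)
      * (x + (τ.im + t : ℝ) * Complex.I) ^ p * Complex.I) (Set.Ioi 0) := fun p =>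
    (integrableOn_latticeFun ha hk p τ).congr_fun_ae (hF p)
  have hreg : ∀ p : ℕ, regIntegral (latticeFun a (w + 2)) p τ = -(b * (τ ^ (p + 1) / (p + 1)))
      + ∫ t in Set.Ioi (0 : ℝ), (latticeSeries a (w + 2) (x + (τ.im + t : ℝ) * Complex.I) - b)
      * (x + (τ.im + t : ℝ) * Complex.I) ^ p * Complex.I := by
    intro p
    rw [regIntegral, valueAtInfty_latticeFun ha hk, ← hb, mul_div_assoc,
      integral_congr_ae (hF p)]
  have hDsum : ∀ t : ℝ, D (τ.im + t) = ∑ p ∈ Finset.range (w + 1),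
      α * ((w.choose p : ℂ) * (-1) ^ p * X ^ (w - p) * Y ^ p) *
      ((latticeSeries a (w + 2) (x + (τ.im + t : ℝ) * Complex.I) - b)
      * (x + (τ.im + t : ℝ) * Complex.I) ^ p * Complex.I) := by
    intro t
    simp only [hD]
    rw [← sum_choose_mul_pow, Finset.mul_sum, Finset.sum_mul, Finset.mul_sum]
    refine Finset.sum_congr rfl fun p _ => ?_
    ring
  have hDint : IntegrableOn (fun t => D (τ.im + t)) (Set.Ioi 0) := by
    simp only [hDsum]
    exact integrable_finsetSum _ fun p _ => (hFint p).const_mul _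
  have hsum : α * ∑ p ∈ Finset.range (w + 1), (w.choose p : ℂ) * (-1) ^ p * X ^ (w - p) * Y ^ p
      * regIntegral (latticeFun a (w + 2)) p τ
      = -(α * b * eichlerPrimitive w X Y τ) + ∫ t in Set.Ioi (0 : ℝ), D (τ.im + t) := by
    simp only [hDsum]
    rw [integral_finsetSum _ fun p _ => (hFint p).const_mul _, eichlerPrimitive, Finset.mul_sum,
      Finset.mul_sum, ← Finset.sum_neg_distrib, ← Finset.sum_add_distrib]
    refine Finset.sum_congr rfl fun p _ => ?_
    rw [hreg, integral_const_mul]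
    ring
  have hint : ∫ t in Set.Ioi (0 : ℝ), (D (τ.im + t)).re
      = (Complex.I * α / (w + 1) * kernelLimit a w Y).re - J (τ.im + 0) := by
    refine integral_Ioi_of_hasDerivAt_of_tendsto' (f := fun t => J (τ.im + t)) (fun t ht => ?_)
      hDint.re (hlim.comp (tendsto_atTop_add_const_left _ _ tendsto_id))
    exact (hderiv _ (add_pos_of_pos_of_nonneg τ.im_pos ht)).comp_const_add _ _
  have hre : (∫ t in Set.Ioi (0 : ℝ), D (τ.im + t)).re = ∫ t in Set.Ioi (0 : ℝ), (D (τ.im + t)).re :=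
    (integral_re hDint).symm
  rw [hsum, Complex.add_re, hre, hint, Complex.neg_re, add_zero]
  simp only [hJ]
  rw [← hτ]
  ring

end Series

/-! ### The action on row vectors -/

section RowAct

variable {N : ℕ}

theorem symp_rowAct (u v : Fin 2 → ZMod N) (γ : SL(2, ℤ)) :
    symp (rowAct u γ) (rowAct v γ) = symp u v := by
  have hdet : (γ.1 0 0 : ZMod N) * γ.1 1 1 - γ.1 0 1 * γ.1 1 0 = 1 := by
    have := γ.2
    rw [Matrix.det_fin_two] at this
    exact_mod_cast congrArg (Int.cast : ℤ → ZMod N) this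
  simp only [symp, rowAct, Matrix.vecMul, dotProduct, Fin.sum_univ_two, Matrix.map_apply]
  linear_combination (u 0 * v 1 - u 1 * v 0) * hdet

theorem redMod_vecMul (u : Fin 2 → ℤ) (γ : SL(2, ℤ)) :
    redMod N (Matrix.vecMul u γ.1) = rowAct (redMod N u) γ := by
  ext i
  simp [redMod, rowAct, Matrix.vecMul, dotProduct, Fin.sum_univ_two]

theorem rowAct_mul (v : Fin 2 → ZMod N) (γ δ : SL(2, ℤ)) :
    rowAct v (γ * δ) = rowAct (rowAct v γ) δ := by
  simp only [rowAct, Matrix.vecMul_vecMul]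
  congr 1
  exact Matrix.map_mul_intCast _ _

theorem rowAct_one (v : Fin 2 → ZMod N) : rowAct v 1 = v := by
  ext i
  fin_cases i <;> simp [rowAct, Matrix.vecMul, dotProduct, Fin.sum_univ_two]

/-- The right action of `γ` as a permutation of `(ℤ/N)²`. -/
def rowActEquiv (γ : SL(2, ℤ)) : (Fin 2 → ZMod N) ≃ (Fin 2 → ZMod N) where
  toFun v := rowAct v γ
  invFun v := rowAct v γ⁻¹
  left_inv v := by
    change rowAct (rowAct v γ) γ⁻¹ = v
    rw [← rowAct_mul, mul_inv_cancel, rowAct_one]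
  right_inv v := by
    change rowAct (rowAct v γ⁻¹) γ = v
    rw [← rowAct_mul, inv_mul_cancel, rowAct_one]

theorem symp_rowAct_inv (v u : Fin 2 → ZMod N) (γ : SL(2, ℤ)) :
    symp (rowAct v γ⁻¹) u = symp v (rowAct u γ) := by
  rw [← symp_rowAct _ u γ]
  congr 1
  exact (rowActEquiv γ).right_inv v

theorem rowAct_of_mem_Gamma (v : Fin 2 → ZMod N) {γ : SL(2, ℤ)}
    (hγ : γ ∈ CongruenceSubgroup.Gamma N) : rowAct v γ = v := by
  rw [CongruenceSubgroup.Gamma_mem] at hγ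
  obtain ⟨h1, h2, h3, h4⟩ := hγ
  ext i
  fin_cases i <;>
    simp [rowAct, Matrix.vecMul, dotProduct, Fin.sum_univ_two, h1, h2, h3, h4]

end RowAct

/-! ### Evaluation of polynomials at real points -/

theorem eval_polyAct {R : Type*} [CommRing R] (P : MvPolynomial (Fin 2) R) (γ : SL(2, ℤ))
    (X Y : R) :
    MvPolynomial.eval ![X, Y] (polyAct P γ)
      = MvPolynomial.eval ![γ.1 0 0 * X + γ.1 0 1 * Y, γ.1 1 0 * X + γ.1 1 1 * Y] P := by
  have h := MvPolynomial.eval₂Hom_bind₁ (RingHom.id R) ![X, Y]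
    (fun i : Fin 2 => ((γ.1 i 0 : ℤ) : MvPolynomial (Fin 2) R) * MvPolynomial.X 0
      + ((γ.1 i 1 : ℤ) : MvPolynomial (Fin 2) R) * MvPolynomial.X 1) P
  refine h.trans ?_
  congr 2
  funext i
  fin_cases i <;> simp

/-- At real points the monomials are real, so taking real parts commutes with evaluation. Such
points already determine a polynomial over ℝ. -/
theorem eval_polyRe (P : MvPolynomial (Fin 2) ℂ) (X Y : ℝ) :
    MvPolynomial.eval ![X, Y] (polyRe P) = (MvPolynomial.eval ![(X : ℂ), (Y : ℂ)] P).re := by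
  rw [polyRe, map_sum, MvPolynomial.eval_eq', Complex.re_sum]
  refine Finset.sum_congr rfl fun m _ => ?_
  rw [MvPolynomial.eval_monomial, Finsupp.prod_fintype _ _ (fun i => pow_zero _)]
  simp only [Fin.prod_univ_two, Matrix.cons_val_zero, Matrix.cons_val_one]
  rw [← Complex.ofReal_pow, ← Complex.ofReal_pow, ← Complex.ofReal_mul, Complex.re_mul_ofReal]

theorem mvPolynomial_ext_of_eval {P Q : MvPolynomial (Fin 2) ℝ}
    (h : ∀ X Y : ℝ, MvPolynomial.eval ![X, Y] P = MvPolynomial.eval ![X, Y] Q) : P = Q := by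
  refine MvPolynomial.funext fun x => ?_
  have : x = ![x 0, x 1] := by ext i; fin_cases i <;> rfl
  rw [this]
  exact h _ _

theorem eval_pPoly (k : ℕ) (A X Y : ℝ) :
    MvPolynomial.eval ![X, Y] (pPoly k A) = A * Y ^ (k - 2) := by
  simp [pPoly]

theorem eval_eichlerIntegral (w : ℕ) (f : UpperHalfPlane → ℂ) (τ : UpperHalfPlane) (X Y : ℝ) :
    MvPolynomial.eval ![(X : ℂ), (Y : ℂ)] (eichlerIntegral (w + 2) f τ)
      = 2 * π * Complex.I * ∑ p ∈ Finset.range (w + 1),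
        (w.choose p : ℂ) * (-1) ^ p * X ^ (w - p) * Y ^ p * regIntegral f p τ := by
  rw [eichlerIntegral, map_sum, Finset.mul_sum]
  refine Finset.sum_congr rfl fun p _ => ?_
  simp
  ring

/-- If the real parts of the Eichler integrals differ from an equivariant family by `A v · Y^(k-2)`,
the real part of the extended cocycle is the coboundary of these polynomials. -/
theorem polyRe_extCocycle_of_equivariant {N k : ℕ}
    {F : (Fin 2 → ZMod N) → UpperHalfPlane → ℂ} {A : (Fin 2 → ZMod N) → ℝ}
    {E : (Fin 2 → ZMod N) → ℝ → ℝ → UpperHalfPlane → ℝ}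
    (hF : ∀ v τ (X Y : ℝ), (MvPolynomial.eval ![(X : ℂ), (Y : ℂ)] (eichlerIntegral k (F v) τ)).re
      = A v * Y ^ (k - 2) - E v X Y τ)
    (hE : ∀ v τ X Y (γ : SL(2, ℤ)), E (rowAct v γ⁻¹) (γ.1 0 0 * X + γ.1 0 1 * Y)
      (γ.1 1 0 * X + γ.1 1 1 * Y) (γ • τ) = E v X Y τ)
    (v : Fin 2 → ZMod N) (γ : SL(2, ℤ)) (τ : UpperHalfPlane) :
    polyRe (extCocycle k F v τ γ) = polyAct (pPoly k (A (rowAct v γ⁻¹))) γ - pPoly k (A v) := by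
  refine mvPolynomial_ext_of_eval fun X Y => ?_
  have h1 := hF (rowAct v γ⁻¹) (γ • τ) (γ.1 0 0 * X + γ.1 0 1 * Y) (γ.1 1 0 * X + γ.1 1 1 * Y)
  rw [hE] at h1
  push_cast at h1
  rw [eval_polyRe, extCocycle, map_sub, map_sub, eval_polyAct, eval_polyAct, eval_pPoly,
    eval_pPoly, Complex.sub_re, h1, hF]
  ring

theorem extCocycle_of_mem_Gamma {N k : ℕ} (F : (Fin 2 → ZMod N) → UpperHalfPlane → ℂ)
    (v : Fin 2 → ZMod N) (τ : UpperHalfPlane) {γ : SL(2, ℤ)}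
    (hγ : γ ∈ CongruenceSubgroup.Gamma N) : extCocycle k F v τ γ = cocycle k (F v) τ γ := by
  rw [extCocycle, cocycle, rowAct_of_mem_Gamma v (inv_mem hγ)]

/-! ### The series `ξ` -/

section Xi

variable {N : ℕ} [NeZero N]

/-- The coefficients `u ↦ μ_N^(v|u)`. -/
noncomputable def sympChar (v u : Fin 2 → ZMod N) : ℂ := ZMod.stdAddChar (symp v u)

theorem norm_sympChar_le (v u : Fin 2 → ZMod N) : ‖sympChar v u‖ ≤ 1 := by
  rw [sympChar, AddChar.norm_apply]

theorem sympChar_neg (v u : Fin 2 → ZMod N) : sympChar v (-u) = starRingEnd ℂ (sympChar v u) := by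
  have : symp v (-u) = -symp v u := by simp [symp]; ring
  rw [sympChar, this, AddChar.map_neg_eq_conj, sympChar]

theorem eisH_eq_latticeFun {k : ℕ} (hk : 3 ≤ k) (v : Fin 2 → ZMod N) (τ : UpperHalfPlane) :
    eisH k v τ = latticeFun (sympChar v) k τ := by
  rw [eisH, latticeFun, latticeSeries]
  refine tsum_subtype_eq_of_support_subset (s := {u : Fin 2 → ℤ | u ≠ 0})
    (f := fun u => sympChar v (redMod N u) / linForm u τ ^ k) ?_
  intro u hu
  rw [Function.mem_support] at hu
  rintro rfl
  apply hu
  simp [linForm, show k ≠ 0 by lia]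

/-- Reindexing by u ↦ uγ works because (vγ⁻¹|u) = (v|uγ). -/
theorem kernelSeries_sympChar_smul (w : ℕ) (X Y : ℝ) (v : Fin 2 → ZMod N) (γ : SL(2, ℤ))
    (τ : UpperHalfPlane) :
    kernelSeries (sympChar (rowAct v γ⁻¹)) w (γ.1 0 0 * X + γ.1 0 1 * Y)
      (γ.1 1 0 * X + γ.1 1 1 * Y) ((γ • τ : UpperHalfPlane) : ℂ)
      = kernelSeries (sympChar v) w X Y τ := by
  let e : (Fin 2 → ℤ) ≃ (Fin 2 → ℤ) :=
    { toFun := fun u => Matrix.vecMul u γ.1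
      invFun := fun u => Matrix.vecMul u γ⁻¹.1
      left_inv := fun u => by
        change Matrix.vecMul (Matrix.vecMul u (γ : Matrix (Fin 2) (Fin 2) ℤ))
          (γ⁻¹ : SL(2, ℤ)) = u
        rw [Matrix.vecMul_vecMul, ← Matrix.SpecialLinearGroup.coe_mul, mul_inv_cancel]
        simp
      right_inv := fun u => by
        change Matrix.vecMul (Matrix.vecMul u ((γ⁻¹ : SL(2, ℤ)) : Matrix (Fin 2) (Fin 2) ℤ)) γ = u
        rw [Matrix.vecMul_vecMul, ← Matrix.SpecialLinearGroup.coe_mul, inv_mul_cancel]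
        simp }
  rw [kernelSeries, kernelSeries,
    ← e.tsum_eq fun u => sympChar v (redMod N u) * eisKernel w X Y u τ]
  refine tsum_congr fun u => ?_
  have : e u = Matrix.vecMul u γ.1 := rfl
  rw [this, eisKernel_smul, redMod_vecMul, sympChar, sympChar, symp_rowAct_inv]

/-- The factor `2 π i · (k-1)! / (2 π i)^k`. -/
noncomputable def xiFactor (k : ℕ) : ℂ :=
  2 * π * Complex.I * (((k - 1).factorial : ℂ) / (2 * (π : ℂ) * Complex.I) ^ k)

theorem conj_xiFactor (w : ℕ) :
    starRingEnd ℂ (xiFactor (w + 2)) = (-1) ^ (w + 1) * xiFactor (w + 2) := by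
  have hc : starRingEnd ℂ (2 * (π : ℂ) * Complex.I) = -(2 * (π : ℂ) * Complex.I) := by
    rw [map_mul, map_mul, Complex.conj_I, Complex.conj_ofReal, map_ofNat]
    ring
  rw [xiFactor, map_mul, map_div₀, map_pow, hc, neg_pow (2 * (π : ℂ) * Complex.I), map_natCast,
    pow_succ (-1 : ℂ) (w + 1)]
  rcases neg_one_pow_eq_or ℂ (w + 1) with h | h <;> rw [h] <;> simp [div_neg]

theorem regIntegral_const_mul {f : UpperHalfPlane → ℂ} {b : ℂ}
    (hb : Tendsto f UpperHalfPlane.atImInfty (𝓝 b)) (c : ℂ) (p : ℕ) (τ : UpperHalfPlane) :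
    regIntegral (fun τ => c * f τ) p τ = c * regIntegral f p τ := by
  have h1 : UpperHalfPlane.valueAtInfty f = b := hb.limUnder_eq
  have h2 : UpperHalfPlane.valueAtInfty (fun τ => c * f τ) = c * b := (hb.const_mul c).limUnder_eq
  rw [regIntegral, regIntegral, h1, h2, mul_add, ← integral_const_mul]
  congr 1
  · ring
  · congr 1
    funext t
    ring

theorem eisXi_eq {k : ℕ} (hk : 3 ≤ k) (v : Fin 2 → ZMod N) :
    eisXi k v = fun τ => ((k - 1).factorial : ℂ) / (2 * (π : ℂ) * Complex.I) ^ k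
      * latticeFun (sympChar v) k τ := by
  funext τ
  rw [eisXi, eisH_eq_latticeFun hk]

/-! ### The Clausen values -/

/-- Orthogonality in the second coordinate is the source of the factor δ_(a,0). -/
theorem sum_sympChar (v : Fin 2 → ZMod N) (m : ZMod N) :
    ∑ j : ZMod N, sympChar v ![m, j]
      = if v 0 = 0 then N * ZMod.stdAddChar (-(m * v 1)) else 0 := by
  have h : ∀ j : ZMod N, sympChar v ![m, j]
      = ZMod.stdAddChar (-(m * v 1)) * ZMod.stdAddChar (j * v 0) := by
    intro j
    rw [sympChar, ← AddChar.map_add_eq_mul]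
    congr 1
    simp [symp]
    ring
  simp only [h]
  rw [← Finset.mul_sum, AddChar.sum_mulShift (v 0) (ZMod.isPrimitive_stdAddChar N), ZMod.card]
  split_ifs <;> push_cast <;> ring

theorem stdAddChar_eq_exp (b : ZMod N) :
    ZMod.stdAddChar b = Complex.exp (((2 * π * (b.val : ℝ) / (N : ℝ) : ℝ) : ℂ) * Complex.I) := by
  have h := ZMod.stdAddChar_coe (N := N) (b.val : ℤ)
  have hb : (((b.val : ℤ)) : ZMod N) = b := by
    rw [Int.cast_natCast, ZMod.natCast_val, ZMod.cast_id', id_eq]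
  rw [hb] at h
  rw [h]
  congr 1
  push_cast
  ring

/-- Positive m give the conjugate of Li_(w+1) and negative m give (-1)^w Li_(w+1). The sum is twice
a real part or -2i times an imaginary part, according to the parity of w. -/
theorem tsum_stdAddChar_inv_abs (b : ZMod N) {w : ℕ} (hw : 1 ≤ w) :
    ∑' m : ℤ, ZMod.stdAddChar (-((m : ZMod N) * b)) * (((|(m : ℝ)|⁻¹ : ℝ) : ℂ) / m ^ w)
      = starRingEnd ℂ (polylog (w + 1) (ZMod.stdAddChar b))
        + (-1) ^ w * polylog (w + 1) (ZMod.stdAddChar b) := by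
  set ζ : ℂ := ZMod.stdAddChar b with hζ
  have hζn : ∀ n : ℕ, ZMod.stdAddChar (((n : ZMod N) + 1) * b) = ζ ^ (n + 1) := by
    intro n
    rw [hζ, ← AddChar.map_nsmul_eq_pow]
    congr 1
    simp
  set f : ℤ → ℂ := fun m =>
    ZMod.stdAddChar (-((m : ZMod N) * b)) * (((|(m : ℝ)|⁻¹ : ℝ) : ℂ) / m ^ w) with hf
  have habs : ∀ n : ℕ, |(n : ℝ) + 1| = n + 1 := fun n => abs_of_pos (by positivity)
  have hn0 : ∀ n : ℕ, (n + 1 : ℂ) ≠ 0 := fun n => by exact_mod_cast Nat.succ_ne_zero n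
  have hpos : ∀ n : ℕ, f (n + 1) = starRingEnd ℂ (ζ ^ (n + 1) / ((n : ℂ) + 1) ^ (w + 1)) := by
    intro n
    simp only [hf]
    push_cast
    rw [AddChar.map_neg_eq_conj, hζn, habs, map_div₀, map_pow _ ((n : ℂ) + 1), map_add, map_one,
      map_natCast]
    push_cast
    have := hn0 n
    field_simp
    ring
  have hneg : ∀ n : ℕ, f (-(n + 1)) = (-1) ^ w * (ζ ^ (n + 1) / ((n : ℂ) + 1) ^ (w + 1)) := by
    intro n
    simp only [hf]
    push_cast
    rw [abs_neg, neg_mul, neg_neg, hζn, habs, neg_pow ((n : ℂ) + 1)]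
    push_cast
    have := hn0 n
    rcases neg_one_pow_eq_or ℂ w with h | h <;> rw [h] <;> field_simp <;> ring
  have hsum : Summable f := by
    refine (summable_int_inv_abs_pow (p := w + 1) (by lia)).of_norm_bounded fun m => le_of_eq ?_
    simp only [hf]
    rw [norm_mul, AddChar.norm_apply, one_mul, norm_div, norm_pow, Complex.norm_real, norm_inv,
      Real.norm_eq_abs, abs_abs, Complex.norm_intCast, pow_succ, mul_inv, div_eq_mul_inv, mul_comm]
  have inj1 : Function.Injective fun n : ℕ => ((n : ℤ) + 1) := fun a b h => by
    simpa using h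
  have inj2 : Function.Injective fun n : ℕ => -((n : ℤ) + 1) := fun a b h => by
    simpa using h
  rw [tsum_of_add_one_of_neg_add_one (hsum.comp_injective inj1) (hsum.comp_injective inj2)]
  simp only [hpos, hneg]
  have hf0 : f 0 = 0 := by simp [hf]
  rw [hf0, add_zero, tsum_mul_left, ← Complex.conj_tsum, polylog]

theorem re_kernelLimit_sympChar {w : ℕ} (hw : 1 ≤ w) (v : Fin 2 → ZMod N) (Y : ℝ) :
    (Complex.I * xiFactor (w + 2) / (w + 1) * kernelLimit (sympChar v) w Y).re
      = aXi (w + 2) v * Y ^ w := by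
  have hN : (N : ℂ) ≠ 0 := Nat.cast_ne_zero.mpr (NeZero.ne N)
  by_cases hv : v 0 = 0
  · have hlim : kernelLimit (sympChar v) w Y = (-Y) ^ w * π *
        (starRingEnd ℂ (polylog (w + 1) (ZMod.stdAddChar (v 1)))
          + (-1) ^ w * polylog (w + 1) (ZMod.stdAddChar (v 1))) := by
      rw [← tsum_stdAddChar_inv_abs (v 1) hw, kernelLimit, ← tsum_mul_left]
      refine tsum_congr fun m => ?_
      rw [sum_sympChar, if_pos hv]
      field_simp
    have hw0 : (w + 1 : ℂ) ≠ 0 := by exact_mod_cast Nat.succ_ne_zero w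
    have hπ : (π : ℂ) ≠ 0 := by exact_mod_cast Real.pi_ne_zero
    -- Here (-1)^w / i^w = i^w collects all powers of i in one factor.
    have hfac : Complex.I * xiFactor (w + 2) / (w + 1) * ((-Y) ^ w * π)
        = (Y : ℂ) ^ w * ((w.factorial : ℂ) / (2 * π) ^ w) * (Complex.I ^ w / 2) := by
      have hI := Complex.I_ne_zero
      have hI2 : (Complex.I ^ w) * (Complex.I ^ w) = (-1) ^ w := by
        rw [← mul_pow, Complex.I_mul_I]
      rw [xiFactor, show w + 2 - 1 = w + 1 from rfl, Nat.factorial_succ, neg_pow (Y : ℂ), ← hI2]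
      push_cast
      field_simp
      ring
    rw [hlim, ← mul_assoc, hfac, aXi, if_pos hv, show w + 2 - 2 = w from rfl,
      show w + 2 - 1 = w + 1 from rfl, clausen, ← stdAddChar_eq_exp]
    set L := polylog (w + 1) (ZMod.stdAddChar (v 1))
    rcases Nat.even_or_odd' w with ⟨j, rfl | rfl⟩
    · have hodd : Odd (2 * j + 1) := ⟨j, rfl⟩
      -- The exponent k - 1 + ⌈k/2⌉ is congruent to j modulo 2, matching i^w = (-1)^j; the odd case
      -- below is analogous.
      have e1 : (2 * j + 1 + (2 * j + 2 + 1) / 2) = j + 2 * (j + 1) := by lia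
      have e2 : starRingEnd ℂ L + (-1) ^ (2 * j) * L = ((2 * L.re : ℝ) : ℂ) := by
        rw [pow_mul, neg_one_sq, one_pow, one_mul, add_comm, Complex.add_conj]
      rw [if_pos hodd, e1, e2, pow_mul Complex.I, Complex.I_sq, pow_add, pow_mul (-1 : ℝ) 2,
        neg_one_sq, one_pow, mul_one]
      have : (Y : ℂ) ^ (2 * j) * (((2 * j).factorial : ℂ) / (2 * π) ^ (2 * j)) * ((-1) ^ j / 2)
          * ((2 * L.re : ℝ) : ℂ) = (((-1) ^ j * (((2 * j).factorial : ℝ) / (2 * π) ^ (2 * j)) * L.re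
          * Y ^ (2 * j) : ℝ) : ℂ) := by
        push_cast; ring
      rw [this, Complex.ofReal_re]
    · have hodd : ¬ Odd (2 * j + 1 + 1) := by
        rw [Nat.not_odd_iff_even]; exact ⟨j + 1, by ring⟩
      have e1 : (2 * j + 1 + 1 + (2 * j + 1 + 2 + 1) / 2) = j + 2 * (j + 2) := by lia
      have e2 : starRingEnd ℂ L + (-1) ^ (2 * j + 1) * L = -((2 * L.im : ℝ) : ℂ) * Complex.I := by
        rw [pow_succ, pow_mul, neg_one_sq, one_pow, neg_mul, ← Complex.sub_conj]
        ring
      rw [if_neg hodd, e1, e2, pow_succ Complex.I, pow_mul Complex.I, Complex.I_sq, pow_add (-1 : ℝ) j,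
        pow_mul (-1 : ℝ) 2, neg_one_sq, one_pow, mul_one]
      have : (Y : ℂ) ^ (2 * j + 1) * (((2 * j + 1).factorial : ℂ) / (2 * π) ^ (2 * j + 1))
          * ((-1) ^ j * Complex.I / 2) * (-((2 * L.im : ℝ) : ℂ) * Complex.I)
          = (((-1) ^ j * (((2 * j + 1).factorial : ℝ) / (2 * π) ^ (2 * j + 1)) * L.im
          * Y ^ (2 * j + 1) : ℝ) : ℂ) := by
        push_cast
        linear_combination (-(Y : ℂ) ^ (2 * j + 1) * (((2 * j + 1).factorial : ℂ)
          / (2 * π) ^ (2 * j + 1)) * (-1) ^ j * L.im) * Complex.I_sq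
      rw [this, Complex.ofReal_re]
  · have : kernelLimit (sympChar v) w Y = 0 := by
      rw [kernelLimit]
      refine (tsum_congr fun m => ?_).trans tsum_zero
      rw [sum_sympChar, if_neg hv]
      simp
    rw [this, aXi, if_neg hv]
    simp

/-- The equivariant part of the real part of the Eichler integral of `ξ_k^v`. -/
noncomputable def xiEquivariant (w : ℕ) (v : Fin 2 → ZMod N) (X Y : ℝ) (τ : UpperHalfPlane) : ℝ :=
  (Complex.I * xiFactor (w + 2) / (w + 1) * kernelSeries (sympChar v) w X Y τ).re

theorem xiEquivariant_smul (w : ℕ) (v : Fin 2 → ZMod N) (τ : UpperHalfPlane) (X Y : ℝ)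
    (γ : SL(2, ℤ)) :
    xiEquivariant w (rowAct v γ⁻¹) (γ.1 0 0 * X + γ.1 0 1 * Y) (γ.1 1 0 * X + γ.1 1 1 * Y) (γ • τ)
      = xiEquivariant w v X Y τ := by
  rw [xiEquivariant, kernelSeries_sympChar_smul, xiEquivariant]

theorem re_eval_eichlerIntegral_eisXi {w : ℕ} (hw : 1 ≤ w) (v : Fin 2 → ZMod N)
    (τ : UpperHalfPlane) (X Y : ℝ) :
    (MvPolynomial.eval ![(X : ℂ), (Y : ℂ)] (eichlerIntegral (w + 2) (eisXi (w + 2) v) τ)).re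
      = aXi (w + 2) v * Y ^ w - xiEquivariant w v X Y τ := by
  have hk : 3 ≤ w + 2 := by lia
  rw [eval_eichlerIntegral, eisXi_eq hk, xiEquivariant, ← re_kernelLimit_sympChar hw,
    ← re_sum_regIntegral (norm_sympChar_le v) (sympChar_neg v) hw (conj_xiFactor w)]
  congr 1
  simp only [regIntegral_const_mul (tendsto_latticeFun (norm_sympChar_le v) hk)]
  rw [xiFactor, Finset.mul_sum, Finset.mul_sum]
  refine Finset.sum_congr rfl fun p _ => ?_
  ring

end Xi

/-! ### Finite Fourier inversion: from ξ to G -/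

section FiniteFourier

variable {N : ℕ} [NeZero N]

theorem sum_sympChar_mul (v t : Fin 2 → ZMod N) :
    ∑ u : Fin 2 → ZMod N, sympChar v u * sympChar u t = if t = v then (N : ℂ) ^ 2 else 0 := by
  have h : ∀ u : Fin 2 → ZMod N, sympChar v u * sympChar u t
      = ZMod.stdAddChar (u 0 * (t 1 - v 1)) * ZMod.stdAddChar (u 1 * (v 0 - t 0)) := by
    intro u
    rw [sympChar, sympChar, ← AddChar.map_add_eq_mul, ← AddChar.map_add_eq_mul]
    congr 1
    simp [symp]
    ring
  simp only [h]
  rw [← (finTwoArrowEquiv (ZMod N)).symm.sum_comp, Fintype.sum_prod_type]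
  simp only [finTwoArrowEquiv_symm_apply, Matrix.cons_val_zero, Matrix.cons_val_one]
  rw [← Finset.sum_mul_sum, AddChar.sum_mulShift _ (ZMod.isPrimitive_stdAddChar N),
    AddChar.sum_mulShift _ (ZMod.isPrimitive_stdAddChar N), ZMod.card]
  by_cases htv : t = v
  · simp [htv]
    ring
  · rw [if_neg htv]
    by_cases h1 : t 1 - v 1 = 0
    · have h0 : v 0 - t 0 ≠ 0 := by
        intro h0
        apply htv
        ext i
        fin_cases i
        · exact (sub_eq_zero.mp h0).symm
        · exact sub_eq_zero.mp h1
      simp [h0]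
    · simp [h1]

/-- This parity allows the Fourier coefficients at u and -u to be merged into real ones. -/
theorem latticeFun_sympChar_neg {k : ℕ} (u : Fin 2 → ZMod N) (τ : UpperHalfPlane) :
    latticeFun (sympChar (-u)) k τ = (-1) ^ k * latticeFun (sympChar u) k τ := by
  rw [latticeFun, latticeFun, latticeSeries, latticeSeries, ← tsum_mul_left,
    ← (Equiv.neg _).tsum_eq]
  refine tsum_congr fun t => ?_
  have h1 : redMod N (-t) = -redMod N t := by ext i; simp [redMod]
  have h2 : linForm (-t) τ = -linForm t τ := by simp [linForm]; ring
  have h3 : ∀ s : Fin 2 → ZMod N, sympChar (-u) (-s) = sympChar u s := by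
    intro s
    simp [sympChar, symp]
  rw [Equiv.neg_apply, h1, h2, h3, neg_pow]
  rcases neg_one_pow_eq_or ℂ k with h | h <;> rw [h] <;> simp [div_neg]

theorem eisG_eq_sum_latticeFun {k : ℕ} (hk : 3 ≤ k) (v : Fin 2 → ZMod N) (τ : UpperHalfPlane) :
    (N : ℂ) ^ 2 * eisG k v τ = ∑ u : Fin 2 → ZMod N, sympChar v u * latticeFun (sympChar u) k τ := by
  have h1 : eisG k v τ
      = ∑' t : Fin 2 → ℤ, (if redMod N t = v then 1 else 0) / linForm t τ ^ k := by
    rw [eisG]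
    refine Eq.trans ?_ (tsum_subtype_eq_of_support_subset
      (s := {t : Fin 2 → ℤ | t ≠ 0 ∧ redMod N t = v})
      (f := fun t => (if redMod N t = v then 1 else 0) / linForm t τ ^ k) ?_)
    · refine tsum_congr fun t => ?_
      rw [if_pos t.2.2, linForm]
    · intro t ht
      rw [Function.mem_support] at ht
      refine ⟨?_, ?_⟩
      · rintro rfl
        apply ht
        simp [linForm, show k ≠ 0 by lia]
      · by_contra h
        apply ht
        rw [if_neg h, zero_div]
  have h2 : ∀ u : Fin 2 → ZMod N, Summable fun t : Fin 2 → ℤ =>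
      sympChar v u * (sympChar u (redMod N t) / linForm t τ ^ k) := fun u =>
    (summable_latticeSeries (norm_sympChar_le u) hk τ.im_pos).mul_left _
  simp only [latticeFun, latticeSeries, ← tsum_mul_left]
  rw [h1, ← Summable.tsum_finsetSum fun u _ => h2 u, ← tsum_mul_left]
  refine tsum_congr fun t => ?_
  have h3 := sum_sympChar_mul v (redMod N t)
  simp only [← mul_div_assoc]
  rw [← Finset.sum_div, h3]
  split_ifs <;> simp

/-- The real coefficients expressing `G_k^v` through the `ξ_k^u`. -/
noncomputable def gCoeff (k : ℕ) (u v : Fin 2 → ZMod N) : ℝ :=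
  (-1) ^ (k / 2) * (2 * π) ^ k / ((N : ℝ) ^ 2 * ((k - 1).factorial : ℝ))
    * (if Even k then Real.cos (2 * π * ((symp u v).val : ℝ) / (N : ℝ))
         else Real.sin (2 * π * ((symp u v).val : ℝ) / (N : ℝ)))

theorem aG_eq_sum (k : ℕ) (v : Fin 2 → ZMod N) : aG k v = ∑ u, gCoeff k u v * aXi k u := by
  rw [aG, Finset.mul_sum]
  refine Finset.sum_congr rfl fun u _ => ?_
  rw [gCoeff]
  ring

omit [NeZero N] in
theorem gCoeff_rowAct (k : ℕ) (u v : Fin 2 → ZMod N) (γ : SL(2, ℤ)) :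
    gCoeff k (rowAct u γ) (rowAct v γ) = gCoeff k u v := by
  rw [gCoeff, symp_rowAct, gCoeff]

theorem sympChar_eq_cos_add_sin (u v : Fin 2 → ZMod N) :
    sympChar u v = (Real.cos (2 * π * ((symp u v).val : ℝ) / (N : ℝ)) : ℂ)
      + (Real.sin (2 * π * ((symp u v).val : ℝ) / (N : ℝ)) : ℂ) * Complex.I := by
  rw [sympChar, stdAddChar_eq_exp, Complex.exp_mul_I, Complex.ofReal_cos, Complex.ofReal_sin]

theorem sympChar_swap (u v : Fin 2 → ZMod N) :
    sympChar v u = starRingEnd ℂ (sympChar u v) := by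
  rw [sympChar, sympChar, ← AddChar.map_neg_eq_conj]
  congr 1
  simp [symp]
  ring

/-- Averaging the inversion formula with its image under u ↦ -u replaces the character by cos (k
even) or -i sin (k odd), and i^k from the normalisation of ξ makes the coefficient real. Reality is
essential, since only real combinations commute with Re. -/
theorem eisG_eq_sum_eisXi {k : ℕ} (hk : 3 ≤ k) (v : Fin 2 → ZMod N) (τ : UpperHalfPlane) :
    eisG k v τ = ∑ u : Fin 2 → ZMod N, (gCoeff k u v : ℂ) * eisXi k u τ := by
  have hN : (N : ℂ) ≠ 0 := Nat.cast_ne_zero.mpr (NeZero.ne N)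
  have hπ : (π : ℂ) ≠ 0 := by exact_mod_cast Real.pi_ne_zero
  have hfac : ((k - 1).factorial : ℂ) ≠ 0 := by exact_mod_cast (k - 1).factorial_ne_zero
  have hI := Complex.I_ne_zero
  have hG := eisG_eq_sum_latticeFun hk v τ
  have hG' : (N : ℂ) ^ 2 * eisG k v τ = ∑ u : Fin 2 → ZMod N,
      (-1) ^ k * starRingEnd ℂ (sympChar v u) * latticeFun (sympChar u) k τ := by
    rw [hG, ← Equiv.sum_comp (Equiv.neg (Fin 2 → ZMod N))]
    refine Finset.sum_congr rfl fun u _ => ?_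
    rw [Equiv.neg_apply, sympChar_neg, latticeFun_sympChar_neg]
    ring
  have hsym : (N : ℂ) ^ 2 * eisG k v τ = ∑ u : Fin 2 → ZMod N,
      (starRingEnd ℂ (sympChar u v) + (-1) ^ k * sympChar u v) / 2
        * latticeFun (sympChar u) k τ := by
    have : (N : ℂ) ^ 2 * eisG k v τ
        = ((N : ℂ) ^ 2 * eisG k v τ + (N : ℂ) ^ 2 * eisG k v τ) / 2 := by ring
    rw [this]
    nth_rewrite 2 [hG']
    rw [hG, ← Finset.sum_add_distrib, Finset.sum_div]
    refine Finset.sum_congr rfl fun u _ => ?_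
    rw [sympChar_swap u v, Complex.conj_conj]
    ring
  have hmul : eisG k v τ = ∑ u : Fin 2 → ZMod N,
      (starRingEnd ℂ (sympChar u v) + (-1) ^ k * sympChar u v) / 2
        * latticeFun (sympChar u) k τ / (N : ℂ) ^ 2 := by
    rw [← Finset.sum_div, ← hsym]
    field_simp
  rw [hmul]
  refine Finset.sum_congr rfl fun u _ => ?_
  rw [eisXi_eq hk]
  set H := latticeFun (sympChar u) k τ
  rw [gCoeff, sympChar_eq_cos_add_sin u v]
  set x := 2 * π * ((symp u v).val : ℝ) / (N : ℝ)
  rw [map_add, map_mul, Complex.conj_ofReal, Complex.conj_ofReal, Complex.conj_I]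
  rcases Nat.even_or_odd' k with ⟨j, hj | hj⟩
  · have he : Even k := ⟨j, by lia⟩
    have hd : k / 2 = j := by lia
    have hIk : Complex.I ^ k = (-1) ^ j := by rw [hj, pow_mul, Complex.I_sq]
    rw [if_pos he, hd, he.neg_one_pow, mul_pow _ Complex.I, hIk]
    push_cast
    have h1 : ((-1 : ℂ) ^ j) ≠ 0 := pow_ne_zero _ (by norm_num)
    field_simp
    ring
  · have ho : Odd k := ⟨j, hj⟩
    have hd : k / 2 = j := by lia
    have hIk : Complex.I ^ k = (-1) ^ j * Complex.I := by rw [hj, pow_succ, pow_mul, Complex.I_sq]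
    rw [if_neg (Nat.not_even_iff_odd.mpr ho), hd, ho.neg_one_pow, mul_pow _ Complex.I, hIk]
    push_cast
    have h1 : ((-1 : ℂ) ^ j) ≠ 0 := pow_ne_zero _ (by norm_num)
    field_simp
    linear_combination (-2 * Complex.sin x * H) * Complex.I_sq

theorem tendsto_eisXi {k : ℕ} (hk : 3 ≤ k) (u : Fin 2 → ZMod N) :
    Tendsto (eisXi k u) UpperHalfPlane.atImInfty
      (𝓝 (((k - 1).factorial : ℂ) / (2 * (π : ℂ) * Complex.I) ^ k * latticeConst (sympChar u) k)) := by
  rw [eisXi_eq hk]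
  exact (tendsto_latticeFun (norm_sympChar_le u) hk).const_mul _

theorem integrableOn_eisXi {k : ℕ} (hk : 3 ≤ k) (u : Fin 2 → ZMod N) (p : ℕ) (τ : UpperHalfPlane) :
    IntegrableOn (fun t : ℝ => (eisXi k u (UpperHalfPlane.ofComplex ((τ : ℂ) + t * Complex.I))
      - UpperHalfPlane.valueAtInfty (eisXi k u)) * ((τ : ℂ) + t * Complex.I) ^ p * Complex.I)
      (Set.Ioi 0) := by
  have h1 : UpperHalfPlane.valueAtInfty (eisXi k u)
      = ((k - 1).factorial : ℂ) / (2 * (π : ℂ) * Complex.I) ^ k * latticeConst (sympChar u) k :=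
    (tendsto_eisXi hk u).limUnder_eq
  rw [h1, eisXi_eq hk]
  refine ((integrableOn_latticeFun (norm_sympChar_le u) hk p τ).const_mul
    (((k - 1).factorial : ℂ) / (2 * (π : ℂ) * Complex.I) ^ k)).congr
    (Eventually.of_forall fun t => ?_)
  ring

theorem regIntegral_eisG {k : ℕ} (hk : 3 ≤ k) (v : Fin 2 → ZMod N) (p : ℕ) (τ : UpperHalfPlane) :
    regIntegral (eisG k v) p τ
      = ∑ u : Fin 2 → ZMod N, (gCoeff k u v : ℂ) * regIntegral (eisXi k u) p τ := by
  have hG : eisG k v = fun τ => ∑ u : Fin 2 → ZMod N, (gCoeff k u v : ℂ) * eisXi k u τ :=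
    funext fun τ => eisG_eq_sum_eisXi hk v τ
  have hval : UpperHalfPlane.valueAtInfty (eisG k v) = ∑ u : Fin 2 → ZMod N,
      (gCoeff k u v : ℂ) * UpperHalfPlane.valueAtInfty (eisXi k u) := by
    rw [hG]
    refine (tendsto_finsetSum _ fun u _ => Tendsto.const_mul _ ?_).limUnder_eq
    have := tendsto_eisXi hk u
    have h2 : UpperHalfPlane.valueAtInfty (eisXi k u) = _ := this.limUnder_eq
    rw [h2]
    exact this
  have hint : ∀ t : ℝ, (eisG k v (UpperHalfPlane.ofComplex ((τ : ℂ) + t * Complex.I))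
      - UpperHalfPlane.valueAtInfty (eisG k v)) * ((τ : ℂ) + t * Complex.I) ^ p * Complex.I
      = ∑ u : Fin 2 → ZMod N, (gCoeff k u v : ℂ) *
        ((eisXi k u (UpperHalfPlane.ofComplex ((τ : ℂ) + t * Complex.I))
      - UpperHalfPlane.valueAtInfty (eisXi k u)) * ((τ : ℂ) + t * Complex.I) ^ p * Complex.I) := by
    intro t
    rw [hval, hG, ← Finset.sum_sub_distrib, Finset.sum_mul, Finset.sum_mul]
    refine Finset.sum_congr rfl fun u _ => ?_
    ring
  simp only [regIntegral, hint]
  rw [integral_finsetSum _ fun u _ => (integrableOn_eisXi hk u p τ).const_mul _, hval,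
    Finset.sum_mul, Finset.sum_div, ← Finset.sum_neg_distrib, ← Finset.sum_add_distrib]
  refine Finset.sum_congr rfl fun u _ => ?_
  rw [integral_const_mul]
  ring

theorem eval_eichlerIntegral_eisG {w : ℕ} (hw : 1 ≤ w) (v : Fin 2 → ZMod N) (τ : UpperHalfPlane)
    (X Y : ℝ) :
    MvPolynomial.eval ![(X : ℂ), (Y : ℂ)] (eichlerIntegral (w + 2) (eisG (w + 2) v) τ)
      = ∑ u : Fin 2 → ZMod N, (gCoeff (w + 2) u v : ℂ) * MvPolynomial.eval ![(X : ℂ), (Y : ℂ)]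
        (eichlerIntegral (w + 2) (eisXi (w + 2) u) τ) := by
  simp only [eval_eichlerIntegral, regIntegral_eisG (k := w + 2) (by lia), Finset.mul_sum]
  rw [Finset.sum_comm]
  refine Finset.sum_congr rfl fun u _ => Finset.sum_congr rfl fun p _ => ?_
  ring

/-- The equivariant part of the real part of the Eichler integral of `G_k^v`. -/
noncomputable def gEquivariant (w : ℕ) (v : Fin 2 → ZMod N) (X Y : ℝ) (τ : UpperHalfPlane) : ℝ :=
  ∑ u : Fin 2 → ZMod N, gCoeff (w + 2) u v * xiEquivariant w u X Y τ

/-- The coefficients depend only on (u|v), so u ↦ uγ⁻¹ permutes the sum compatibly with the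
equivariance of each ξ^u. -/
theorem gEquivariant_smul (w : ℕ) (v : Fin 2 → ZMod N) (τ : UpperHalfPlane) (X Y : ℝ)
    (γ : SL(2, ℤ)) :
    gEquivariant w (rowAct v γ⁻¹) (γ.1 0 0 * X + γ.1 0 1 * Y) (γ.1 1 0 * X + γ.1 1 1 * Y) (γ • τ)
      = gEquivariant w v X Y τ := by
  rw [gEquivariant, ← (rowActEquiv γ⁻¹).sum_comp, gEquivariant]
  refine Finset.sum_congr rfl fun u _ => ?_
  change gCoeff (w + 2) (rowAct u γ⁻¹) (rowAct v γ⁻¹) * xiEquivariant w (rowAct u γ⁻¹) _ _ _ = _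
  rw [gCoeff_rowAct, xiEquivariant_smul]

theorem re_eval_eichlerIntegral_eisG {w : ℕ} (hw : 1 ≤ w) (v : Fin 2 → ZMod N)
    (τ : UpperHalfPlane) (X Y : ℝ) :
    (MvPolynomial.eval ![(X : ℂ), (Y : ℂ)] (eichlerIntegral (w + 2) (eisG (w + 2) v) τ)).re
      = aG (w + 2) v * Y ^ w - gEquivariant w v X Y τ := by
  rw [eval_eichlerIntegral_eisG hw, Complex.re_sum, aG_eq_sum, gEquivariant, Finset.sum_mul,
    ← Finset.sum_sub_distrib]
  refine Finset.sum_congr rfl fun u _ => ?_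
  rw [Complex.re_ofReal_mul, re_eval_eichlerIntegral_eisXi hw]
  ring

end FiniteFourier

/-! ### Assembly -/

theorem coboundary_pPoly (Γ : Subgroup SL(2, ℤ)) (k : ℕ) (A : ℝ) :
    coboundary Γ (pPoly k A)
      = A • coboundary Γ (MvPolynomial.X 1 ^ (k - 2) : MvPolynomial (Fin 2) ℝ) := by
  funext γ
  simp only [coboundary, Pi.smul_apply, pPoly, polyAct, map_mul, MvPolynomial.smul_eq_C_mul,
    MvPolynomial.algHom_C, MvPolynomial.algebraMap_eq]
  ring

theorem theorem4p3 (N k : ℕ) [NeZero N] (hk : 3 ≤ k) (v : Fin 2 → ZMod N) :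
    -- the extended cocycle of the series `ξ`, on all of `SL₂(ℤ)`
    (∀ (γ : SL(2, ℤ)) (τ : UpperHalfPlane),
      polyRe (extCocycle k (fun w : Fin 2 → ZMod N => eisXi k w) v τ γ)
        = polyAct (pPoly k (aXi k (rowAct v γ⁻¹))) γ - pPoly k (aXi k v)) ∧
    -- the cocycle of `ξ_k^v` on `Γ(N)`
    (∀ γ ∈ CongruenceSubgroup.Gamma N, rowAct v γ = v) ∧
    (∀ τ : UpperHalfPlane,
      (fun γ : CongruenceSubgroup.Gamma N => polyRe (cocycle k (eisXi k v) τ (γ : SL(2, ℤ))))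
        = coboundary (CongruenceSubgroup.Gamma N) (pPoly k (aXi k v))) ∧
    coboundary (CongruenceSubgroup.Gamma N) (pPoly k (aXi k v))
      = aXi k v • coboundary (CongruenceSubgroup.Gamma N)
          (MvPolynomial.X 1 ^ (k - 2) : MvPolynomial (Fin 2) ℝ) ∧
    -- the extended cocycle of the series `G`, on all of `SL₂(ℤ)`
    (∀ (γ : SL(2, ℤ)) (τ : UpperHalfPlane),
      polyRe (extCocycle k (fun w : Fin 2 → ZMod N => eisG k w) v τ γ)
        = polyAct (pPoly k (aG k (rowAct v γ⁻¹))) γ - pPoly k (aG k v)) ∧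
    -- the cocycle of `G_k^v` on `Γ(N)`
    (∀ τ : UpperHalfPlane,
      (fun γ : CongruenceSubgroup.Gamma N => polyRe (cocycle k (eisG k v) τ (γ : SL(2, ℤ))))
        = coboundary (CongruenceSubgroup.Gamma N) (pPoly k (aG k v))) ∧
    coboundary (CongruenceSubgroup.Gamma N) (pPoly k (aG k v))
      = aG k v • coboundary (CongruenceSubgroup.Gamma N)
          (MvPolynomial.X 1 ^ (k - 2) : MvPolynomial (Fin 2) ℝ) := by

  obtain ⟨w, rfl⟩ : ∃ w, k = w + 2 := ⟨k - 2, by lia⟩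
  -- This is the force of k ≥ 3: it secures absolute convergence of the lattice and kernel series.
  have hw : 1 ≤ w := by lia
  have hXi := polyRe_extCocycle_of_equivariant
    (F := fun w' : Fin 2 → ZMod N => eisXi (w + 2) w') (re_eval_eichlerIntegral_eisXi hw)
    (fun v τ X Y γ => xiEquivariant_smul w v τ X Y γ)
  have hG := polyRe_extCocycle_of_equivariant
    (F := fun w' : Fin 2 → ZMod N => eisG (w + 2) w') (re_eval_eichlerIntegral_eisG hw)
    (fun v τ X Y γ => gEquivariant_smul w v τ X Y γ)
  refine ⟨fun γ τ => hXi v γ τ, fun γ hγ => rowAct_of_mem_Gamma v hγ, fun τ => ?_,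
    coboundary_pPoly _ _ _, fun γ τ => hG v γ τ, fun τ => ?_, coboundary_pPoly _ _ _⟩
  · funext γ
    have h := hXi v γ τ
    rw [extCocycle_of_mem_Gamma _ v τ γ.2, rowAct_of_mem_Gamma v (inv_mem γ.2)] at h
    exact h
  · funext γ
    have h := hG v γ τ
    rw [extCocycle_of_mem_Gamma _ v τ γ.2, rowAct_of_mem_Gamma v (inv_mem γ.2)] at h
    exact h
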